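/- Let $\mathbf{Pord}$ be the category of (small) preorders and monotone maps, enriched in itself by the pointwise preorder on hom-sets. For a preorder $A$ let $P(A)$ be the poset of down-closed subsets of $A$, ordered by inclusion. For a monotone map $f\colon A\to B$ put $$Kf=\{(\phi,b)\in P(A)\times B:\ f(a)\le b\text{ for all }a\in\phi\},\qquad \lambda_f(a)=(\{a'\in A: a'\le a\},f(a)),\qquad \rho_f(\phi,b)=b,$$ with the order of $P(A)\times B$. A square $(h,k)\colon f\to g$ acts by $(\phi,b)\mapsto({\downarrow}h(\phi),k(b))$, and, with comultiplication $(\phi,b)\mapsto(\phi,(\phi,b))$ and multiplication $(\Psi,b)\mapsto(\bigcup\{\phi:(\phi,b')\in\Psi\},b)$, this is a $\mathbf{Pord}$-enriched algebraic weak factorisation system (AWFS) $(\mathsf L,\mathsf R)$ on $\mathbf{Pord}$. *Terminology.* Let $(\mathsf E,\mathsf M)$ be a $\mathbf{Pord}$-enriched AWFS on $\mathbf{Pord}$; it is *cocontinuous* if its functor $K\colon\mathbf{Pord}^{\mathbf 2}\to\mathbf{Pord}$ preserves small colimits. Let $\mathbb J$ be a small internal category in $\mathbf{Pord}$-categories,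 with category of arrows $\mathcal J$, and let $U$ be an internal functor from $\mathbb J$ to the internal category of squares $\mathbf{Pord}^{\mathbf 2}\rightrightarrows\mathbf{Pord}$. Let $\mathbb J^{\pitchfork\!\!\pitchfork_{\mathsf M}}$ be the internal category over the squares of $\mathbf{Pord}$ whose objects of arrows are morphisms $g\colon X\to Y$ equipped with an $\mathsf M$-algebra structure on each map $\mathbf{Pord}(\operatorname{cod}Uj,X)\to\mathbf{Pord}^{\mathbf 2}(Uj,g)$, $d\mapsto(d\cdot Uj,g\cdot d)$, natural in $j\in\mathcal J$ and compatible with the vertical composition of $\mathbb J$. An AWFS $(\mathsf L,\mathsf R)$ is *cofibrantly generated with respect to* $(\mathsf E,\mathsf M)$ if for some such $\mathbb J$ the internal category of $\mathsf R$-algebras is isomorphic to $\mathbb J^{\pitchfork\!\!\pitchfork_{\mathsf M}}$ over the internal category of squares. It is *cofibrantly KZ-generated* if this holds for the AWFS whose $\mathsf M$-algebras are the monotone maps equipped with a left adjoint whose unit is an identity. **Theorem.** The AWFS $(\mathsf L,\mathsf R)$ is lax orthogonal; a monotone map $f$ carries an $\mathsf L$-coalgebra structure if and only if it belongs to the left class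 of the underlying weak factorisation system (WFS), and if and only if it is full ($f(a)\le f(a')$ implies $a\le a'$); a preorder $X$ carries an $\mathsf R$-algebra structure on $X\to1$ if and only if $X\to 1$ belongs to the right class of the underlying WFS, and if and only if $X$ is a complete lattice; and the morphisms of such algebras over $1$ are the maps preserving all suprema. Moreover: 1. $(\mathsf L,\mathsf R)$ is not cofibrantly KZ-generated; 2. $(\mathsf L,\mathsf R)$ is not cofibrantly generated with respect to any cocontinuous $\mathbf{Pord}$-enriched AWFS on $\mathbf{Pord}$; 3. the underlying WFS of $(\mathsf L,\mathsf R)$ is not cofibrantly generated: there is no small set of morphisms $I$ such that its right class consists of the morphisms with the right lifting property against $I$; 4. every regular cardinal $\beta$, regarded as an ordinal, is the $\beta$-filtered colimit (union) in $\mathbf{Pord}$ of the complete lattices $\operatorname{succ}(\mu)=\{\nu:\nu\le\mu\}$, $\mu<\beta$, along the inclusions, which preserve all suprema, but $\beta$ is not itself a complete lattice. -/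

import Mathlib

open CategoryTheory Limits

universe u v w

noncomputable section

/-! ### Categories enriched in preorders -/

/-- A category enriched in the cartesian closed category of preorders: a category whose hom-sets
are preordered in such a way that composition is monotone. -/
class PordCategory (C : Type w) [Category.{v} C] where
  [homPreorder : ∀ X Y : C, Preorder (X ⟶ Y)]
  comp_mono : ∀ {X Y Z : C} {f f' : X ⟶ Y} {g g' : Y ⟶ Z}, f ≤ f' → g ≤ g' → f ≫ g ≤ f' ≫ g'

attribute [instance, reducible] PordCategory.homPreorder

/-- The category of preorders is enriched in itself by the pointwise preorder on monotone maps. -/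
instance Preord.instPordCategory : PordCategory Preord.{u} where
  homPreorder X Y := Preorder.lift fun f : X ⟶ Y => (f : X → Y)
  comp_mono := by
    intro X Y Z f f' g g' hf hg x
    exact le_trans (g.hom.monotone (hf x)) (hg (f' x))

/-- Commutative squares from `f` to `g`, i.e. morphisms `f ⟶ g` in the arrow category `C²`. -/
@[ext]
structure Square {C : Type w} [Category.{v} C] {A B X Y : C} (f : A ⟶ B) (g : X ⟶ Y) where
  left : A ⟶ X
  right : B ⟶ Y
  comm : f ≫ right = left ≫ g

namespace Square

variable {C : Type w} [Category.{v} C]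

/-- The identity square. -/
@[simps]
def id {A B : C} (f : A ⟶ B) : Square f f := ⟨𝟙 A, 𝟙 B, by simp⟩

/-- Horizontal composition of squares. -/
@[simps]
def comp {A B X Y Z W : C} {f : A ⟶ B} {g : X ⟶ Y} {h : Z ⟶ W} (s : Square f g)
    (t : Square g h) : Square f h :=
  ⟨s.left ≫ t.left, s.right ≫ t.right, by
    rw [← Category.assoc, s.comm, Category.assoc, t.comm, Category.assoc]⟩

/-- The hom-preorders of `C²` are componentwise. -/
instance [PordCategory C] {A B X Y : C} (f : A ⟶ B) (g : X ⟶ Y) : Preorder (Square f g) :=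
  Preorder.lift fun s : Square f g => (s.left, s.right)

end Square

/-! ### Algebraic weak factorisation systems -/

/-- A preorder-enriched functorial factorisation `A --lam f--> K f --rho f--> B` of the
morphisms `f : A ⟶ B` of a preorder-enriched category. -/
structure FunFact (C : Type w) [Category.{v} C] [PordCategory C] where
  K : ∀ {A B : C}, (A ⟶ B) → C
  lam : ∀ {A B : C} (f : A ⟶ B), A ⟶ K f
  rho : ∀ {A B : C} (f : A ⟶ B), K f ⟶ B
  fac : ∀ {A B : C} (f : A ⟶ B), lam f ≫ rho f = f
  map : ∀ {A B X Y : C} {f : A ⟶ B} {g : X ⟶ Y}, Square f g → (K f ⟶ K g)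
  map_id : ∀ {A B : C} (f : A ⟶ B), map (Square.id f) = 𝟙 (K f)
  map_comp : ∀ {A B X Y Z W : C} {f : A ⟶ B} {g : X ⟶ Y} {h : Z ⟶ W}
    (s : Square f g) (t : Square g h), map (s.comp t) = map s ≫ map t
  map_mono : ∀ {A B X Y : C} {f : A ⟶ B} {g : X ⟶ Y} {s t : Square f g}, s ≤ t → map s ≤ map t
  lam_map : ∀ {A B X Y : C} {f : A ⟶ B} {g : X ⟶ Y} (s : Square f g),
    lam f ≫ map s = s.left ≫ lam g
  rho_map : ∀ {A B X Y : C} {f : A ⟶ B} {g : X ⟶ Y} (s : Square f g),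
    rho f ≫ s.right = map s ≫ rho g

namespace FunFact

variable {C : Type w} [Category.{v} C] [PordCategory C] (F : FunFact C)

/-- The factorisation as a functor `K : C² ⥤ C`. -/
def functor : Arrow C ⥤ C where
  obj f := F.K f.hom
  map {f g} s := F.map (f := f.hom) (g := g.hom) ⟨s.left, s.right, (Arrow.w s).symm⟩
  map_id f := F.map_id f.hom
  map_comp {f g h} s t := F.map_comp (f := f.hom) (g := g.hom) (h := h.hom)
    ⟨s.left, s.right, (Arrow.w s).symm⟩ ⟨t.left, t.right, (Arrow.w t).symm⟩

/-- The action on morphisms of the endofunctor `L : C² ⥤ C²`, `f ↦ lam f`. -/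
def mapL {A B X Y : C} {f : A ⟶ B} {g : X ⟶ Y} (s : Square f g) : Square (F.lam f) (F.lam g) :=
  ⟨s.left, F.map s, F.lam_map s⟩

/-- The action on morphisms of the endofunctor `R : C² ⥤ C²`, `f ↦ rho f`. -/
def mapR {A B X Y : C} {f : A ⟶ B} {g : X ⟶ Y} (s : Square f g) : Square (F.rho f) (F.rho g) :=
  ⟨F.map s, s.right, F.rho_map s⟩

/-- The copoint `Φ : L ⟶ 1`. -/
def copoint {A B : C} (f : A ⟶ B) : Square (F.lam f) f := ⟨𝟙 A, F.rho f, by simp [F.fac]⟩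

/-- The point `Λ : 1 ⟶ R`. -/
def point {A B : C} (f : A ⟶ B) : Square f (F.rho f) := ⟨F.lam f, 𝟙 B, by simp [F.fac]⟩

end FunFact

/-- A preorder-enriched algebraic weak factorisation system: a functorial factorisation with a
comultiplication `Σ_f = (1, sig f) : lam f ⟶ lam (lam f)` making `L` a comonad, and a
multiplication `Π_f = (pi f, 1) : rho (rho f) ⟶ rho f` making `R` a monad, such that the squares
`(sig f, pi f) : lam (rho f) ⟶ rho (lam f)` form a mixed distributive law. All axioms of the
distributive law other than `distrib` follow from the (co)monad axioms. -/
structure AWFS (C : Type w) [Category.{v} C] [PordCategory C] extends FunFact C where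
  sig : ∀ {A B : C} (f : A ⟶ B), K f ⟶ K (lam f)
  pi : ∀ {A B : C} (f : A ⟶ B), K (rho f) ⟶ K f
  lam_sig : ∀ {A B : C} (f : A ⟶ B), lam f ≫ sig f = 𝟙 A ≫ lam (lam f)
  rho_pi : ∀ {A B : C} (f : A ⟶ B), rho (rho f) ≫ 𝟙 B = pi f ≫ rho f
  sig_nat : ∀ {A B X Y : C} {f : A ⟶ B} {g : X ⟶ Y} (s : Square f g),
    map s ≫ sig g = sig f ≫ map (toFunFact.mapL s)
  pi_nat : ∀ {A B X Y : C} {f : A ⟶ B} {g : X ⟶ Y} (s : Square f g),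
    map (toFunFact.mapR s) ≫ pi g = pi f ≫ map s
  sig_rho : ∀ {A B : C} (f : A ⟶ B), sig f ≫ rho (lam f) = 𝟙 (K f)
  sig_copoint : ∀ {A B : C} (f : A ⟶ B), sig f ≫ map (toFunFact.copoint f) = 𝟙 (K f)
  sig_coassoc : ∀ {A B : C} (f : A ⟶ B), sig f ≫ sig (lam f) =
    sig f ≫ map (f := lam f) (g := lam (lam f)) ⟨𝟙 A, sig f, lam_sig f⟩
  lam_pi : ∀ {A B : C} (f : A ⟶ B), lam (rho f) ≫ pi f = 𝟙 (K f)
  point_pi : ∀ {A B : C} (f : A ⟶ B), map (toFunFact.point f) ≫ pi f = 𝟙 (K f)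
  pi_assoc : ∀ {A B : C} (f : A ⟶ B), pi (rho f) ≫ pi f =
    map (f := rho (rho f)) (g := rho f) ⟨pi f, 𝟙 B, rho_pi f⟩ ≫ pi f
  distrib : ∀ {A B : C} (f : A ⟶ B), pi f ≫ sig f =
    sig (rho f) ≫ map (f := lam (rho f)) (g := rho (lam f))
      ⟨sig f, pi f, by rw [lam_pi f, sig_rho f]⟩ ≫ pi (lam f)

namespace AWFS

variable {C : Type w} [Category.{v} C] [PordCategory C] (W : AWFS C)

/-- The AWFS is lax orthogonal: the 2-monad `R` and the 2-comonad `L` are lax idempotent. In the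
preorder-enriched setting lax idempotency of a monad `(T, i, m)` is the inequality `T i ≤ i T`
(the equations on the modification `T i ⟶ i T` hold automatically), and dually `G ε ≤ ε G` for a
comonad `(G, ε, δ)`. -/
def IsLaxOrthogonal : Prop :=
  (∀ {A B : C} (f : A ⟶ B), W.mapR (W.point f) ≤ W.point (W.rho f)) ∧
  (∀ {A B : C} (f : A ⟶ B), W.mapL (W.copoint f) ≤ W.copoint (W.lam f))

/-- An `L`-coalgebra structure `(1, s) : f ⟶ lam f` on `f`. -/
@[ext]
structure Coalg {A B : C} (f : A ⟶ B) where
  str : B ⟶ W.K f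
  comm : f ≫ str = 𝟙 A ≫ W.lam f
  counit : str ≫ W.rho f = 𝟙 B
  coassoc : str ≫ W.sig f = str ≫ W.map (f := f) (g := W.lam f) ⟨𝟙 A, str, comm⟩

/-- An `R`-algebra structure `(p, 1) : rho f ⟶ f` on `f`. -/
@[ext]
structure Alg {A B : C} (f : A ⟶ B) where
  str : W.K f ⟶ A
  comm : W.rho f ≫ 𝟙 B = str ≫ f
  unit : W.lam f ≫ str = 𝟙 A
  assoc : W.map (f := W.rho f) (g := f) ⟨str, 𝟙 B, comm⟩ ≫ str = W.pi f ≫ str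

variable {W}

/-- The square `s : f ⟶ g` is a morphism of `R`-algebras. -/
def IsAlgHom {A B X Y : C} {f : A ⟶ B} {g : X ⟶ Y} (p : W.Alg f) (q : W.Alg g)
    (s : Square f g) : Prop :=
  p.str ≫ s.left = W.map s ≫ q.str

variable (W)

/-- The left class of the underlying WFS: morphisms admitting a coalgebra structure for the
copointed endofunctor `(L, Φ)`. -/
def leftClass : MorphismProperty C := fun A B f =>
  ∃ s : B ⟶ W.K f, f ≫ s = W.lam f ∧ s ≫ W.rho f = 𝟙 B

/-- The right class of the underlying WFS: morphisms admitting an algebra structure for the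
pointed endofunctor `(R, Λ)`. -/
def rightClass : MorphismProperty C := fun A B f =>
  ∃ p : W.K f ⟶ A, W.lam f ≫ p = 𝟙 A ∧ p ≫ f = W.rho f

variable {W}

/-- The square `(1, t) : lam (f ≫ g) ⟶ f`, where `t` is the lift of the cofree coalgebra
`lam (f ≫ g)` against the algebra `g`. -/
def Alg.compSquare {A B Y : C} {f : A ⟶ B} {g : B ⟶ Y} (q : W.Alg g) :
    Square (W.lam (f ≫ g)) f where
  left := 𝟙 A
  right := W.map (f := f ≫ g) (g := g) ⟨f, 𝟙 Y, by simp⟩ ≫ q.str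
  comm := by
    rw [← Category.assoc, W.lam_map]
    simp [q.unit]

theorem map_map {A B X Y Z T : C} {f : A ⟶ B} {g : X ⟶ Y} {h : Z ⟶ T}
    (s : Square f g) (t : Square g h) : W.map s ≫ W.map t = W.map (s.comp t) :=
  (W.map_comp s t).symm

theorem map_map_assoc {A B X Y Z T V : C} {f : A ⟶ B} {g : X ⟶ Y} {h : Z ⟶ T}
    (s : Square f g) (t : Square g h) (z : W.K h ⟶ V) :
    W.map s ≫ W.map t ≫ z = W.map (s.comp t) ≫ z := by
  rw [← Category.assoc, map_map]

theorem map_sig_assoc {A B X Y V : C} {f : A ⟶ B} {g : X ⟶ Y} (s : Square f g)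
    (z : W.K (W.lam g) ⟶ V) :
    W.map s ≫ W.sig g ≫ z = W.sig f ≫ W.map (W.mapL s) ≫ z := by
  rw [← Category.assoc, W.sig_nat, Category.assoc]

theorem Alg.pi_map_str {A B X Y : C} {f : A ⟶ B} {g : X ⟶ Y} (q : W.Alg g) (s : Square f g) :
    W.pi f ≫ W.map s ≫ q.str =
      W.map ((W.mapR s).comp (⟨q.str, 𝟙 Y, q.comm⟩ : Square (W.rho g) g)) ≫ q.str := by
  rw [← Category.assoc, ← W.pi_nat, Category.assoc, ← q.assoc, map_map_assoc]

theorem Alg.compStr_comp {A B Y : C} {f : A ⟶ B} {g : B ⟶ Y} (p : W.Alg f) (q : W.Alg g) :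
    (W.sig (f ≫ g) ≫ W.map q.compSquare ≫ p.str) ≫ f = (Alg.compSquare (f := f) q).right := by
  have h1 : p.str ≫ f = W.rho f := by rw [← p.comm, Category.comp_id]
  simp only [Category.assoc]
  rw [h1, ← W.rho_map, ← Category.assoc, W.sig_rho, Category.id_comp]

/-- The vertical composition of `R`-algebras: the canonical `R`-algebra structure on `f ≫ g`
determined by `R`-algebra structures on `f` and `g`. Its structure map is obtained by lifting the
cofree coalgebra `lam (f ≫ g)` first against `g` and then against `f`. -/
def Alg.comp {A B Y : C} {f : A ⟶ B} {g : B ⟶ Y} (p : W.Alg f) (q : W.Alg g) :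
    W.Alg (f ≫ g) where
  str := W.sig (f ≫ g) ≫ W.map q.compSquare ≫ p.str
  comm := by
    have h2 : q.str ≫ g = W.rho g := by rw [← q.comm, Category.comp_id]
    rw [← Category.assoc _ f g, Alg.compStr_comp p q]
    simp only [Alg.compSquare, Category.assoc]
    rw [h2, ← W.rho_map]
  unit := by
    rw [← Category.assoc, W.lam_sig, Category.id_comp, ← Category.assoc, W.lam_map]
    simp [Alg.compSquare, p.unit]
  assoc := by
    have hc := Alg.compStr_comp p q
    set c := W.sig (f ≫ g) ≫ W.map q.compSquare ≫ p.str with hcdef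
    have hcomm : W.rho (f ≫ g) ≫ 𝟙 Y = c ≫ f ≫ g := by
      have h2 : q.str ≫ g = W.rho g := by rw [← q.comm, Category.comp_id]
      rw [← Category.assoc, hc]
      simp only [Alg.compSquare, Category.assoc]
      rw [h2, ← W.rho_map]
    -- the two sides lie over the same map into the middle object
    have ht : W.map (f := W.rho (f ≫ g)) (g := f ≫ g) ⟨c, 𝟙 Y, hcomm⟩ ≫
        (Alg.compSquare (f := f) q).right = W.pi (f ≫ g) ≫ (Alg.compSquare (f := f) q).right := by
      have e1 : (Alg.compSquare (f := f) q).right =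
          W.map (f := f ≫ g) (g := g) ⟨f, 𝟙 Y, by simp⟩ ≫ q.str := rfl
      rw [e1, Alg.pi_map_str, map_map_assoc]
      congr 2
      ext
      · simp only [Square.comp_left]
        rw [hc, e1]
        rfl
      · simp [FunFact.mapR]
    calc W.map (f := W.rho (f ≫ g)) (g := f ≫ g) ⟨c, 𝟙 Y, hcomm⟩ ≫ c
        = W.sig (W.rho (f ≫ g)) ≫ W.map ((W.mapL (f := W.rho (f ≫ g)) (g := f ≫ g)
            ⟨c, 𝟙 Y, hcomm⟩).comp q.compSquare) ≫ p.str := by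
          exact (map_sig_assoc _ _).trans (by rw [map_map_assoc])
      _ = W.pi (f ≫ g) ≫ c := by
          conv_rhs => rw [hcdef]
          rw [← Category.assoc (W.pi (f ≫ g)), W.distrib]
          simp only [Category.assoc]
          rw [Alg.pi_map_str, map_map_assoc]
          congr 3
          ext
          · simp [FunFact.mapR, FunFact.mapL, Alg.compSquare, hcdef]
          · simp only [Square.comp_right, FunFact.mapL, FunFact.mapR]
            rw [ht, Category.comp_id]

/-- `R`-algebra structures lift uniquely along pullback squares: the unique algebra structure on
the pullback `f` of an algebra `g` for which the pullback square is a morphism of algebras. -/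
def Alg.pullback {A B X Y : C} {f : A ⟶ B} {g : X ⟶ Y} (q : W.Alg g) {h : A ⟶ X} {k : B ⟶ Y}
    (sq : IsPullback h f g k) : W.Alg f where
  str := sq.lift (W.map (f := f) (g := g) ⟨h, k, sq.w.symm⟩ ≫ q.str) (W.rho f) (by
    rw [Category.assoc, ← q.comm, Category.comp_id, ← W.rho_map])
  comm := by simp
  unit := by
    apply sq.hom_ext
    · rw [Category.assoc, sq.lift_fst, ← Category.assoc, W.lam_map, Category.assoc, q.unit]
      simp
    · rw [Category.assoc, sq.lift_snd, W.fac]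
      simp
  assoc := by
    apply sq.hom_ext
    · simp only [Category.assoc, sq.lift_fst]
      rw [Alg.pi_map_str, map_map_assoc]
      congr 2
      ext
      · simp [FunFact.mapR]
      · simp [FunFact.mapR]
    · simp only [Category.assoc, sq.lift_snd]
      rw [← W.rho_map, ← W.rho_pi]

theorem Alg.pullback_isAlgHom {A B X Y : C} {f : A ⟶ B} {g : X ⟶ Y} (q : W.Alg g) {h : A ⟶ X}
    {k : B ⟶ Y} (sq : IsPullback h f g k) :
    IsAlgHom (q.pullback sq) q ⟨h, k, sq.w.symm⟩ :=
  sq.lift_fst _ _ _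

end AWFS

/-! ### Small internal categories over the squares of a category -/

/-- A small internal category in the category of preorder-enriched categories (a small
preorder-enriched double category). The object of objects is the preorder-enriched category `Obj`.
The object of arrows has as objects the vertical morphisms `i : Vert a b`; a morphism `i ⟶ j` in
it is a triple of `h : a ⟶ a'`, `k : b ⟶ b'` and a cell `σ : Cell i j h k`, and `cellLE` is the
preorder on these morphisms. -/
structure PordDouble where
  Obj : Type u
  [cat : SmallCategory Obj]
  [pord : PordCategory Obj]
  Vert : Obj → Obj → Type u
  Cell : ∀ {a b a' b' : Obj}, Vert a b → Vert a' b' → (a ⟶ a') → (b ⟶ b') → Type u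
  /-- Identities and composition of the category of arrows. -/
  hId : ∀ {a b : Obj} (i : Vert a b), Cell i i (𝟙 a) (𝟙 b)
  hComp : ∀ {a b a' b' a'' b'' : Obj} {i : Vert a b} {j : Vert a' b'} {l : Vert a'' b''}
    {h : a ⟶ a'} {k : b ⟶ b'} {h' : a' ⟶ a''} {k' : b' ⟶ b''},
    Cell i j h k → Cell j l h' k' → Cell i l (h ≫ h') (k ≫ k')
  hId_comp : ∀ {a b a' b' : Obj} {i : Vert a b} {j : Vert a' b'} {h : a ⟶ a'} {k : b ⟶ b'}
    (σ : Cell i j h k), HEq (hComp (hId i) σ) σ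
  hComp_id : ∀ {a b a' b' : Obj} {i : Vert a b} {j : Vert a' b'} {h : a ⟶ a'} {k : b ⟶ b'}
    (σ : Cell i j h k), HEq (hComp σ (hId j)) σ
  hComp_assoc : ∀ {a₁ b₁ a₂ b₂ a₃ b₃ a₄ b₄ : Obj} {i₁ : Vert a₁ b₁} {i₂ : Vert a₂ b₂}
    {i₃ : Vert a₃ b₃} {i₄ : Vert a₄ b₄} {h₁ : a₁ ⟶ a₂} {k₁ : b₁ ⟶ b₂} {h₂ : a₂ ⟶ a₃}
    {k₂ : b₂ ⟶ b₃} {h₃ : a₃ ⟶ a₄} {k₃ : b₃ ⟶ b₄} (σ₁ : Cell i₁ i₂ h₁ k₁)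
    (σ₂ : Cell i₂ i₃ h₂ k₂) (σ₃ : Cell i₃ i₄ h₃ k₃),
    HEq (hComp (hComp σ₁ σ₂) σ₃) (hComp σ₁ (hComp σ₂ σ₃))
  /-- The preorder enrichment of the category of arrows. -/
  cellLE : ∀ {a b a' b' : Obj} {i : Vert a b} {j : Vert a' b'} {h h₁ : a ⟶ a'} {k k₁ : b ⟶ b'},
    Cell i j h k → Cell i j h₁ k₁ → Prop
  cellLE_refl : ∀ {a b a' b' : Obj} {i : Vert a b} {j : Vert a' b'} {h : a ⟶ a'} {k : b ⟶ b'}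
    (σ : Cell i j h k), cellLE σ σ
  cellLE_trans : ∀ {a b a' b' : Obj} {i : Vert a b} {j : Vert a' b'} {h h₁ h₂ : a ⟶ a'}
    {k k₁ k₂ : b ⟶ b'} {σ : Cell i j h k} {σ₁ : Cell i j h₁ k₁} {σ₂ : Cell i j h₂ k₂},
    cellLE σ σ₁ → cellLE σ₁ σ₂ → cellLE σ σ₂
  hComp_mono : ∀ {a b a' b' a'' b'' : Obj} {i : Vert a b} {j : Vert a' b'} {l : Vert a'' b''}
    {h h₁ : a ⟶ a'} {k k₁ : b ⟶ b'} {h' h₁' : a' ⟶ a''} {k' k₁' : b' ⟶ b''}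
    {σ : Cell i j h k} {σ₁ : Cell i j h₁ k₁} {τ : Cell j l h' k'} {τ₁ : Cell j l h₁' k₁'},
    cellLE σ σ₁ → cellLE τ τ₁ → cellLE (hComp σ τ) (hComp σ₁ τ₁)
  /-- Source and target are enriched functors. -/
  src_mono : ∀ {a b a' b' : Obj} {i : Vert a b} {j : Vert a' b'} {h h₁ : a ⟶ a'} {k k₁ : b ⟶ b'}
    {σ : Cell i j h k} {σ₁ : Cell i j h₁ k₁}, cellLE σ σ₁ → h ≤ h₁
  tgt_mono : ∀ {a b a' b' : Obj} {i : Vert a b} {j : Vert a' b'} {h h₁ : a ⟶ a'} {k k₁ : b ⟶ b'}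
    {σ : Cell i j h k} {σ₁ : Cell i j h₁ k₁}, cellLE σ σ₁ → k ≤ k₁
  /-- The enriched functor of vertical identities. -/
  vId : ∀ a : Obj, Vert a a
  vIdCell : ∀ {a a' : Obj} (h : a ⟶ a'), Cell (vId a) (vId a') h h
  vIdCell_id : ∀ a : Obj, vIdCell (𝟙 a) = hId (vId a)
  vIdCell_comp : ∀ {a a' a'' : Obj} (h : a ⟶ a') (h' : a' ⟶ a''),
    vIdCell (h ≫ h') = hComp (vIdCell h) (vIdCell h')
  vIdCell_mono : ∀ {a a' : Obj} {h h' : a ⟶ a'}, h ≤ h' → cellLE (vIdCell h) (vIdCell h')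
  /-- The enriched functor of vertical composition. -/
  vComp : ∀ {a b c : Obj}, Vert a b → Vert b c → Vert a c
  vCompCell : ∀ {a b c a' b' c' : Obj} {i : Vert a b} {j : Vert b c} {i' : Vert a' b'}
    {j' : Vert b' c'} {h : a ⟶ a'} {k : b ⟶ b'} {l : c ⟶ c'},
    Cell i i' h k → Cell j j' k l → Cell (vComp i j) (vComp i' j') h l
  vCompCell_id : ∀ {a b c : Obj} (i : Vert a b) (j : Vert b c),
    vCompCell (hId i) (hId j) = hId (vComp i j)
  vCompCell_comp : ∀ {a b c a' b' c' a'' b'' c'' : Obj} {i : Vert a b} {j : Vert b c}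
    {i' : Vert a' b'} {j' : Vert b' c'} {i'' : Vert a'' b''} {j'' : Vert b'' c''}
    {h : a ⟶ a'} {k : b ⟶ b'} {l : c ⟶ c'} {h' : a' ⟶ a''} {k' : b' ⟶ b''} {l' : c' ⟶ c''}
    (σ : Cell i i' h k) (τ : Cell j j' k l) (σ' : Cell i' i'' h' k') (τ' : Cell j' j'' k' l'),
    vCompCell (hComp σ σ') (hComp τ τ') = hComp (vCompCell σ τ) (vCompCell σ' τ')
  vCompCell_mono : ∀ {a b c a' b' c' : Obj} {i : Vert a b} {j : Vert b c} {i' : Vert a' b'}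
    {j' : Vert b' c'} {h h₁ : a ⟶ a'} {k k₁ : b ⟶ b'} {l l₁ : c ⟶ c'}
    {σ : Cell i i' h k} {τ : Cell j j' k l} {σ₁ : Cell i i' h₁ k₁} {τ₁ : Cell j j' k₁ l₁},
    cellLE σ σ₁ → cellLE τ τ₁ → cellLE (vCompCell σ τ) (vCompCell σ₁ τ₁)
  /-- Vertical composition is associative and unital. -/
  vId_comp : ∀ {a b : Obj} (i : Vert a b), vComp (vId a) i = i
  vComp_id : ∀ {a b : Obj} (i : Vert a b), vComp i (vId b) = i
  vComp_assoc : ∀ {a b c d : Obj} (i : Vert a b) (j : Vert b c) (l : Vert c d),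
    vComp (vComp i j) l = vComp i (vComp j l)
  vIdCell_vComp : ∀ {a b a' b' : Obj} {i : Vert a b} {j : Vert a' b'} {h : a ⟶ a'} {k : b ⟶ b'}
    (σ : Cell i j h k), HEq (vCompCell (vIdCell h) σ) σ
  vComp_vIdCell : ∀ {a b a' b' : Obj} {i : Vert a b} {j : Vert a' b'} {h : a ⟶ a'} {k : b ⟶ b'}
    (σ : Cell i j h k), HEq (vCompCell σ (vIdCell k)) σ
  vCompCell_assoc : ∀ {a b c d a' b' c' d' : Obj} {i : Vert a b} {j : Vert b c} {l : Vert c d}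
    {i' : Vert a' b'} {j' : Vert b' c'} {l' : Vert c' d'} {h : a ⟶ a'} {k : b ⟶ b'}
    {m : c ⟶ c'} {n : d ⟶ d'} (σ : Cell i i' h k) (τ : Cell j j' k m) (ω : Cell l l' m n),
    HEq (vCompCell (vCompCell σ τ) ω) (vCompCell σ (vCompCell τ ω))

attribute [instance] PordDouble.cat PordDouble.pord

/-- An internal functor from `J` to the internal category `C² ⇉ C` of squares in `C`.
Monotonicity on the object of arrows follows from `obj_mono`, since cells of squares are pairs of
morphisms of `C` and are compared componentwise. -/
structure PordDouble.ToSq (J : PordDouble.{u}) (C : Type w) [Category.{v} C] [PordCategory C] where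
  obj : J.Obj ⥤ C
  obj_mono : ∀ {a b : J.Obj} {h h' : a ⟶ b}, h ≤ h' → obj.map h ≤ obj.map h'
  vert : ∀ {a b : J.Obj}, J.Vert a b → (obj.obj a ⟶ obj.obj b)
  cell : ∀ {a b a' b' : J.Obj} {i : J.Vert a b} {j : J.Vert a' b'} {h : a ⟶ a'} {k : b ⟶ b'},
    J.Cell i j h k → vert i ≫ obj.map k = obj.map h ≫ vert j
  vert_id : ∀ a : J.Obj, vert (J.vId a) = 𝟙 (obj.obj a)
  vert_comp : ∀ {a b c : J.Obj} (i : J.Vert a b) (j : J.Vert b c),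
    vert (J.vComp i j) = vert i ≫ vert j

/-! ### Lifting structures and cofibrant generation -/

section Lifting

variable {C : Type w} [Category.{u} C] [PordCategory C]

/-- The comparison morphism of preorders `C(T, X) ⟶ C²(i, g)`, `d ↦ (i ≫ d, d ≫ g)`, for
`i : S ⟶ T` and `g : X ⟶ Y`. -/
def liftMap {S T X Y : C} (i : S ⟶ T) (g : X ⟶ Y) :
    Preord.of (T ⟶ X) ⟶ Preord.of (Square i g) :=
  Preord.ofHom
    { toFun := fun d => ⟨i ≫ d, d ≫ g, by simp⟩
      monotone' := fun _ _ hd =>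
        ⟨PordCategory.comp_mono le_rfl hd, PordCategory.comp_mono hd le_rfl⟩ }

/-- `C²(i', g) ⟶ C²(i, g)`, precomposition with a square `i ⟶ i'`. -/
def Square.pre {S T S' T' X Y : C} {i : S ⟶ T} {i' : S' ⟶ T'} (s : Square i i') (g : X ⟶ Y) :
    Preord.of (Square i' g) ⟶ Preord.of (Square i g) :=
  Preord.ofHom
    { toFun := fun t => s.comp t
      monotone' := fun _ _ ht =>
        ⟨PordCategory.comp_mono le_rfl ht.1, PordCategory.comp_mono le_rfl ht.2⟩ }

/-- `C²(i, g) ⟶ C²(i, g')`, postcomposition with a square `g ⟶ g'`. -/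
def Square.post {S T X Y X' Y' : C} (i : S ⟶ T) {g : X ⟶ Y} {g' : X' ⟶ Y'} (s : Square g g') :
    Preord.of (Square i g) ⟶ Preord.of (Square i g') :=
  Preord.ofHom
    { toFun := fun t => t.comp s
      monotone' := fun _ _ ht =>
        ⟨PordCategory.comp_mono ht.1 le_rfl, PordCategory.comp_mono ht.2 le_rfl⟩ }

/-- `liftMap i g` is contravariantly functorial in `i`. -/
def liftMapPre {S T S' T' X Y : C} {i : S ⟶ T} {i' : S' ⟶ T'} (s : Square i i') (g : X ⟶ Y) :
    Square (liftMap i' g) (liftMap i g) where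
  left := Preord.ofHom
    { toFun := fun d => s.right ≫ d
      monotone' := fun _ _ hd => PordCategory.comp_mono le_rfl hd }
  right := s.pre g
  comm := by
    ext d
    · change s.left ≫ i' ≫ d = i ≫ s.right ≫ d
      rw [← Category.assoc, ← s.comm, Category.assoc]
    · change s.right ≫ d ≫ g = (s.right ≫ d) ≫ g
      rw [Category.assoc]

/-- `liftMap i g` is functorial in `g`. -/
def liftMapPost {S T X Y X' Y' : C} (i : S ⟶ T) {g : X ⟶ Y} {g' : X' ⟶ Y'} (s : Square g g') :
    Square (liftMap i g) (liftMap i g') where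
  left := Preord.ofHom
    { toFun := fun d => d ≫ s.left
      monotone' := fun _ _ hd => PordCategory.comp_mono hd le_rfl }
  right := Square.post i s
  comm := by
    ext d
    · change (i ≫ d) ≫ s.left = i ≫ d ≫ s.left
      rw [Category.assoc]
    · change (d ≫ g) ≫ s.right = (d ≫ s.left) ≫ g'
      rw [Category.assoc, s.comm, Category.assoc]

theorem Preord.isPullback_of {P X Y Z : Preord.{u}} {p : P ⟶ X} {q : P ⟶ Y} {f : X ⟶ Z}
    {g : Y ⟶ Z} (w : p ≫ f = q ≫ g) (ex : ∀ x y, f x = g y → ∃ z, p z = x ∧ q z = y)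
    (inj : ∀ z z', p z = p z' → q z = q z' → z = z')
    (le : ∀ z z', p z ≤ p z' → q z ≤ q z' → z ≤ z') : IsPullback p q f g := by
  refine ⟨⟨w⟩, ⟨PullbackCone.IsLimit.mk w (fun s => ?_) ?_ ?_ ?_⟩⟩
  · have hs : ∀ t : s.pt, f (s.fst t) = g (s.snd t) := fun t =>
      ConcreteCategory.congr_hom s.condition t
    exact Preord.ofHom
      { toFun := fun t => (ex _ _ (hs t)).choose
        monotone' := fun t t' h => le _ _
          (by rw [(ex _ _ (hs t)).choose_spec.1, (ex _ _ (hs t')).choose_spec.1]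
              exact s.fst.hom.monotone h)
          (by rw [(ex _ _ (hs t)).choose_spec.2, (ex _ _ (hs t')).choose_spec.2]
              exact s.snd.hom.monotone h) }
  · intro s
    ext t
    exact (ex _ _ (ConcreteCategory.congr_hom s.condition t)).choose_spec.1
  · intro s
    ext t
    exact (ex _ _ (ConcreteCategory.congr_hom s.condition t)).choose_spec.2
  · intro s m h1 h2
    ext t
    refine inj _ _ ?_ ?_
    · exact (ConcreteCategory.congr_hom h1 t).trans
        (ex _ _ (ConcreteCategory.congr_hom s.condition t)).choose_spec.1.symm
    · exact (ConcreteCategory.congr_hom h2 t).trans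
        (ex _ _ (ConcreteCategory.congr_hom s.condition t)).choose_spec.2.symm

/-- `C²(i, f) ⟶ C(T, B)`, `(x, y) ↦ y`, for `i : S ⟶ T` and `f : A ⟶ B`. -/
def squareRight {S T A B : C} (i : S ⟶ T) (f : A ⟶ B) :
    Preord.of (Square i f) ⟶ Preord.of (T ⟶ B) :=
  Preord.ofHom { toFun := fun t => t.right, monotone' := fun _ _ h => h.2 }

/-- `C²(j, g) ⟶ C(T, X)`, `(x, y) ↦ x`, for `j : T ⟶ Z` and `g : X ⟶ Y`. -/
def squareLeft {T Z X Y : C} (j : T ⟶ Z) (g : X ⟶ Y) :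
    Preord.of (Square j g) ⟶ Preord.of (T ⟶ X) :=
  Preord.ofHom { toFun := fun t => t.left, monotone' := fun _ _ h => h.1 }

/-- The square `(1, g) : f ⟶ f ≫ g`. -/
def Square.extend {A B Y : C} (f : A ⟶ B) (g : B ⟶ Y) : Square f (f ≫ g) := ⟨𝟙 A, g, by simp⟩

/-- The square `(f, 1) : f ≫ g ⟶ g`. -/
def Square.drop {A B Y : C} (f : A ⟶ B) (g : B ⟶ Y) : Square (f ≫ g) g := ⟨f, 𝟙 Y, by simp⟩

theorem liftMap_comp_right {S T A B Y : C} (i : S ⟶ T) (f : A ⟶ B) (g : B ⟶ Y) :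
    liftMap i f ≫ Square.post i (Square.extend f g) = liftMap i (f ≫ g) := by
  ext d
  · change (i ≫ d) ≫ 𝟙 A = i ≫ d
    simp
  · change (d ≫ f) ≫ g = d ≫ f ≫ g
    simp

theorem isPullback_right {S T A B Y : C} (i : S ⟶ T) (f : A ⟶ B) (g : B ⟶ Y) :
    IsPullback (squareRight i f) (Square.post i (Square.extend f g)) (liftMap i g)
      (Square.post i (Square.drop f g)) := by
  refine Preord.isPullback_of ?_ ?_ ?_ ?_
  · ext t
    · change i ≫ t.right = (t.left ≫ 𝟙 A) ≫ f
      rw [t.comm, Category.comp_id]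
    · change t.right ≫ g = (t.right ≫ g) ≫ 𝟙 Y
      simp
  · intro x y h
    have h1 : i ≫ x = y.left ≫ f := congrArg Square.left h
    have h2 : x ≫ g = y.right ≫ 𝟙 Y := congrArg Square.right h
    refine ⟨⟨y.left, x, h1⟩, rfl, ?_⟩
    ext
    · exact Category.comp_id _
    · exact h2.trans (Category.comp_id _)
  · intro z z' h1 h2
    have h3 : z.left ≫ 𝟙 A = z'.left ≫ 𝟙 A := congrArg Square.left h2
    ext
    · simpa using h3
    · exact h1
  · intro z z' h1 h2
    have h3 : z.left ≫ 𝟙 A ≤ z'.left ≫ 𝟙 A := h2.1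
    rw [Category.comp_id, Category.comp_id] at h3
    exact ⟨h3, h1⟩

theorem liftMap_comp_left {S T Z X Y : C} (i : S ⟶ T) (j : T ⟶ Z) (g : X ⟶ Y) :
    liftMap j g ≫ (Square.drop i j).pre g = liftMap (i ≫ j) g := by
  ext d
  · change i ≫ j ≫ d = (i ≫ j) ≫ d
    simp
  · change 𝟙 Z ≫ d ≫ g = d ≫ g
    simp

theorem isPullback_left {S T Z X Y : C} (i : S ⟶ T) (j : T ⟶ Z) (g : X ⟶ Y) :
    IsPullback (squareLeft j g) ((Square.drop i j).pre g) (liftMap i g)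
      ((Square.extend i j).pre g) := by
  refine Preord.isPullback_of ?_ ?_ ?_ ?_
  · ext t
    · change i ≫ t.left = 𝟙 S ≫ i ≫ t.left
      simp
    · change t.left ≫ g = j ≫ 𝟙 Z ≫ t.right
      rw [Category.id_comp, t.comm]
  · intro x y h
    have h1 : i ≫ x = 𝟙 S ≫ y.left := congrArg Square.left h
    have h2 : x ≫ g = j ≫ y.right := congrArg Square.right h
    refine ⟨⟨x, y.right, h2.symm⟩, rfl, ?_⟩
    ext
    · exact h1.trans (Category.id_comp _)
    · exact Category.id_comp _
  · intro z z' h1 h2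
    have h3 : 𝟙 Z ≫ z.right = 𝟙 Z ≫ z'.right := congrArg Square.right h2
    ext
    · exact h1
    · simpa using h3
  · intro z z' h1 h2
    have h3 : 𝟙 Z ≫ z.right ≤ 𝟙 Z ≫ z'.right := h2.2
    rw [Category.id_comp, Category.id_comp] at h3
    exact ⟨h1, h3⟩

/-- The composition of lifting structures against a fixed `i`: the `M`-algebra structure on
`liftMap i (f ≫ g)` obtained from `M`-algebra structures on `liftMap i f` and `liftMap i g`. -/
def AWFS.Alg.compRight {EM : AWFS Preord.{u}} {S T A B Y : C} {i : S ⟶ T} {f : A ⟶ B} {g : B ⟶ Y}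
    (φ : EM.Alg (liftMap i f)) (γ : EM.Alg (liftMap i g)) : EM.Alg (liftMap i (f ≫ g)) :=
  liftMap_comp_right i f g ▸ φ.comp (γ.pullback (isPullback_right i f g))

/-- The `M`-algebra structure on `liftMap (i ≫ j) g` obtained from `M`-algebra structures on
`liftMap i g` and `liftMap j g`. -/
def AWFS.Alg.compLeft {EM : AWFS Preord.{u}} {S T Z X Y : C} {i : S ⟶ T} {j : T ⟶ Z} {g : X ⟶ Y}
    (φ : EM.Alg (liftMap i g)) (γ : EM.Alg (liftMap j g)) : EM.Alg (liftMap (i ≫ j) g) :=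
  liftMap_comp_left i j g ▸ γ.comp (φ.pullback (isPullback_left i j g))

/-- For an internal category `J` over the squares of `C` and an AWFS `(E, M)` on preorders, the
objects over `g` of the category of arrows of the internal category of lifting structures against
`J`: an `M`-algebra structure on the transformation `liftMap (U -) g` of presheaves of preorders
on the category of arrows of `J` (i.e. pointwise algebra structures natural with respect to
cells), compatible with the vertical composition of `J`. -/
structure LiftStr (EM : AWFS Preord.{u}) {J : PordDouble.{u}} (U : J.ToSq C) {X Y : C}
    (g : X ⟶ Y) where
  alg : ∀ {a b : J.Obj} (i : J.Vert a b), EM.Alg (liftMap (U.vert i) g)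
  natural : ∀ {a b a' b' : J.Obj} {i : J.Vert a b} {j : J.Vert a' b'} {h : a ⟶ a'} {k : b ⟶ b'}
    (σ : J.Cell i j h k), AWFS.IsAlgHom (alg j) (alg i)
      (liftMapPre (⟨U.obj.map h, U.obj.map k, U.cell σ⟩ : Square (U.vert i) (U.vert j)) g)
  comp : ∀ {a b c : J.Obj} (i : J.Vert a b) (j : J.Vert b c),
    (U.vert_comp i j ▸ alg (J.vComp i j) : EM.Alg (liftMap (U.vert i ≫ U.vert j) g)) =
      (alg i).compLeft (alg j)

/-- The AWFS `W = (L, R)` on `C` is cofibrantly generated, with respect to the AWFS `EM = (E, M)`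
on preorders, by the small internal category `J` over the squares of `C`: the internal category of
`R`-algebras is isomorphic, over the internal category of squares of `C`, to the internal category
of lifting structures against `J`. Both have `C` as object of objects, and on both the category of
arrows is locally a full sub-preorder of `C²`; so an isomorphism over the squares of `C` amounts to
a bijection between structures on each morphism `f` of `C` for which the same squares are
morphisms, and which respects the vertical composition (identities carry a unique structure). -/
def AWFS.IsGeneratedBy (W : AWFS C) (EM : AWFS Preord.{u}) {J : PordDouble.{u}} (U : J.ToSq C) :
    Prop :=
  ∃ e : ∀ {X Y : C} (f : X ⟶ Y), W.Alg f ≃ LiftStr EM U f,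
    (∀ {A B X Y : C} {f : A ⟶ B} {g : X ⟶ Y} (p : W.Alg f) (q : W.Alg g) (s : Square f g),
      AWFS.IsAlgHom p q s ↔ ∀ {a b : J.Obj} (i : J.Vert a b),
        AWFS.IsAlgHom ((e f p).alg i) ((e g q).alg i) (liftMapPost (U.vert i) s)) ∧
    (∀ {A B Y : C} {f : A ⟶ B} {g : B ⟶ Y} (p : W.Alg f) (q : W.Alg g) {a b : J.Obj}
      (i : J.Vert a b),
      (e (f ≫ g) (p.comp q)).alg i = ((e f p).alg i).compRight ((e g q).alg i))

/-- `W` is cofibrantly generated with respect to the AWFS `EM` on preorders: it is generated by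
some small internal category over the squares of `C`. -/
def AWFS.IsCofibrantlyGenerated (W : AWFS C) (EM : AWFS Preord.{u}) : Prop :=
  ∃ (J : PordDouble.{u}) (U : J.ToSq C), W.IsGeneratedBy EM U

end Lifting

/-- An AWFS on preorders is cocontinuous when the functor `K : C² ⥤ C` of its factorisation
preserves small colimits. Only (conical) colimits of ordinary diagrams are required to be
preserved; this is implied by the preservation of all small weighted colimits. -/
def AWFS.IsCocontinuous (EM : AWFS Preord.{u}) : Prop :=
  PreservesColimitsOfSize.{u, u} EM.functor

/-- The underlying WFS of `W` is cofibrantly generated in the usual sense: its right class consists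
of the morphisms with the right lifting property against a small set of morphisms. -/
def AWFS.IsWFSCofibrantlyGenerated {C : Type w} [Category.{u} C] [PordCategory C]
    (W : AWFS C) : Prop :=
  ∃ I : MorphismProperty C, MorphismProperty.IsSmall.{u} I ∧ W.rightClass = I.rlp

/-! ### The AWFS of right adjoints left inverses -/

/-- The order on the lax colimit of a monotone map `f : A → B`: the disjoint union of `A` and `B`
in which moreover `b ≤ a` whenever `b ≤ f a`. -/
inductive LaxColim {A B : Type u} (f : A → B) : Type u
  | inA : A → LaxColim f
  | inB : B → LaxColim f

namespace LaxColim

variable {A B : Type u} [Preorder A] [Preorder B] {f : A →o B}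

protected def LE : LaxColim f → LaxColim f → Prop
  | inA a, inA a' => a ≤ a'
  | inB b, inB b' => b ≤ b'
  | inB b, inA a => b ≤ f a
  | inA _, inB _ => False

instance : Preorder (LaxColim f) where
  le := LaxColim.LE
  le_refl x := by cases x <;> exact le_refl _
  le_trans x y z hxy hyz := by
    cases x <;> cases y <;> cases z <;> simp only [LaxColim.LE] at *
    · exact le_trans hxy hyz
    · exact le_trans hxy (f.monotone hyz)
    · exact le_trans hxy hyz
    · exact le_trans hxy hyz

/-- The morphism from the lax colimit induced by a lax cocone in which the triangle over `B`
commutes up to an inequality. -/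
def desc {Z : Type u} [Preorder Z] (a : A →o Z) (b : B →o Z) (h : ∀ x, b (f x) ≤ a x) :
    LaxColim f →o Z where
  toFun
    | inA x => a x
    | inB y => b y
  monotone' x y hxy := by
    cases x <;> cases y
    · exact a.monotone hxy
    · exact hxy.elim
    · exact le_trans (b.monotone hxy) (h _)
    · exact b.monotone hxy

def incA : A →o LaxColim f := ⟨inA, fun _ _ h => h⟩

def incB : B →o LaxColim f := ⟨inB, fun _ _ h => h⟩

end LaxColim

/-- The functorial factorisation of a monotone map `f : A ⟶ B` through its lax colimit. -/
def raliFunFact : FunFact Preord.{u} where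
  K f := Preord.of (LaxColim f.hom)
  lam f := Preord.ofHom LaxColim.incA
  rho {A B} f := Preord.ofHom (LaxColim.desc f.hom OrderHom.id fun _ => le_rfl)
  fac _ := rfl
  map {A B X Y f g} s := Preord.ofHom (LaxColim.desc (LaxColim.incA.comp s.left.hom)
    (LaxColim.incB.comp s.right.hom) fun x =>
      le_of_eq (α := Y) (ConcreteCategory.congr_hom s.comm x))
  map_id f := by ext x; cases x <;> rfl
  map_comp s t := by ext x; cases x <;> rfl
  map_mono {A B X Y f g s t} h x := by
    cases x with
    | inA a => exact h.1 a
    | inB b => exact h.2 b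
  lam_map _ := rfl
  rho_map s := by
    ext x
    cases x with
    | inA a => exact ConcreteCategory.congr_hom s.comm a
    | inB b => rfl

/-- The AWFS `(E, M)` on preorders whose `M`-algebras are the RALIs: an `M`-algebra structure on
`f : A ⟶ B` amounts to a left adjoint `l : B ⟶ A` of `f` with identity unit, i.e. `f ∘ l = 1` and
`l b ≤ a ↔ b ≤ f a`. -/
def raliAWFS : AWFS Preord.{u} where
  toFunFact := raliFunFact
  sig {A B} f := Preord.ofHom (LaxColim.desc LaxColim.incA (LaxColim.incB.comp LaxColim.incB)
    fun x => le_refl (α := B) (f x))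
  pi {A B} f := Preord.ofHom (LaxColim.desc OrderHom.id LaxColim.incB fun
    | .inA a => le_refl (α := B) (f a)
    | .inB b => le_refl (α := B) b)
  lam_sig f := rfl
  rho_pi f := by ext x; rcases x with (x | x) | x <;> rfl
  sig_nat s := by ext x; cases x <;> rfl
  pi_nat s := by ext x; rcases x with (x | x) | x <;> rfl
  sig_rho f := by ext x; cases x <;> rfl
  sig_copoint f := by ext x; cases x <;> rfl
  sig_coassoc f := by ext x; cases x <;> rfl
  lam_pi f := by ext x; cases x <;> rfl
  point_pi f := by ext x; cases x <;> rfl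
  pi_assoc f := by ext x; rcases x with ((x | x) | x) | x <;> rfl
  distrib f := by ext x; rcases x with (x | x) | x <;> rfl

/-- Cofibrant KZ-generation: cofibrant generation with respect to the AWFS on preorders whose
right algebras are the RALIs. -/
def AWFS.IsCofibrantlyKZGenerated {C : Type w} [Category.{u} C] [PordCategory C]
    (W : AWFS C) : Prop :=
  W.IsCofibrantlyGenerated raliAWFS

/-! ### The AWFS of full maps and complete lattices -/

/-- The underlying preorder of the object `K f`, for `f : A ⟶ B`: pairs `(φ, b)` of a down-closed
subset `φ` of `A` and `b ∈ B` such that `f a ≤ b` for all `a ∈ φ`, ordered componentwise. -/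
abbrev FullK {A B : Type u} [Preorder A] [Preorder B] (f : A → B) : Type u :=
  {x : LowerSet A × B // ∀ a ∈ x.1, f a ≤ x.2}

/-- The direct image `P A → P X` on down-closed subsets along `h : A → X`: the down-closure of the
image. -/
def LowerSet.push {A X : Type u} [Preorder X] [LE A] (h : A → X) (φ : LowerSet A) : LowerSet X :=
  lowerClosure (h '' φ)

theorem LowerSet.mem_push {A X : Type u} [Preorder X] [LE A] {h : A → X} {φ : LowerSet A} {x : X} :
    x ∈ LowerSet.push h φ ↔ ∃ a ∈ φ, x ≤ h a := by
  simp [LowerSet.push]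

/-- The union `⋃ {φ | (φ, b) ∈ Ψ}`. -/
def FullK.join {A B : Type u} [Preorder A] [Preorder B] {f : A → B} (Ψ : LowerSet (FullK f)) :
    LowerSet A :=
  ⨆ y ∈ Ψ, y.1.1

theorem FullK.mem_join {A B : Type u} [Preorder A] [Preorder B] {f : A → B}
    {Ψ : LowerSet (FullK f)} {a : A} : a ∈ FullK.join Ψ ↔ ∃ y ∈ Ψ, a ∈ y.1.1 := by
  simp only [FullK.join, LowerSet.mem_iSup₂_iff, exists_prop]

theorem FullK.ext {A B : Type u} [Preorder A] [Preorder B] {f : A → B} {x y : FullK f}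
    (h1 : ∀ a, a ∈ x.1.1 ↔ a ∈ y.1.1) (h2 : x.1.2 = y.1.2) : x = y :=
  Subtype.ext (Prod.ext (SetLike.ext h1) h2)

/-- The factorisation `f = (A ⟶ K f ⟶ B)`, `a ↦ (↓a, f a)`, `(φ, b) ↦ b`. On a square `(h, k)`
it is given by `(φ, b) ↦ (↓h(φ), k b)`. -/
def fullFunFact : FunFact Preord.{u} where
  K f := Preord.of (FullK f)
  lam {A B} f := Preord.ofHom
    { toFun := fun a => ⟨(LowerSet.Iic a, f a), fun _ h => f.hom.monotone h⟩
      monotone' := fun _ _ h => ⟨fun _ h' => le_trans h' h, f.hom.monotone h⟩ }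
  rho {A B} f := Preord.ofHom { toFun := fun x => x.1.2, monotone' := fun _ _ h => h.2 }
  fac _ := rfl
  map {A B X Y f g} s := Preord.ofHom
    { toFun := fun x => ⟨(LowerSet.push s.left x.1.1, s.right x.1.2), by
        intro y hy
        obtain ⟨a, ha, hya⟩ := LowerSet.mem_push.1 hy
        refine le_trans (g.hom.monotone hya) ?_
        refine le_trans (le_of_eq (ConcreteCategory.congr_hom s.comm a).symm) ?_
        exact s.right.hom.monotone (x.2 a ha)⟩
      monotone' := fun x y h => ⟨by
        intro z hz
        obtain ⟨a, ha, hza⟩ := LowerSet.mem_push.1 hz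
        exact LowerSet.mem_push.2 ⟨a, h.1 ha, hza⟩, s.right.hom.monotone h.2⟩ }
  map_id f := by
    refine Preord.ext fun x => FullK.ext (fun a => ?_) rfl
    exact LowerSet.mem_push.trans ⟨fun ⟨b, hb, h⟩ => x.1.1.lower h hb, fun h => ⟨a, h, le_rfl⟩⟩
  map_comp s t := by
    refine Preord.ext fun x => FullK.ext (fun a => ?_) rfl
    refine LowerSet.mem_push.trans (Iff.trans ?_ LowerSet.mem_push.symm)
    constructor
    · rintro ⟨b, hb, h⟩
      exact ⟨s.left b, LowerSet.mem_push.2 ⟨b, hb, le_rfl⟩, h⟩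
    · rintro ⟨c, hc, h⟩
      obtain ⟨b, hb, h'⟩ := LowerSet.mem_push.1 hc
      exact ⟨b, hb, le_trans h (t.left.hom.monotone h')⟩
  map_mono {A B X Y f g s t} h x := by
    refine ⟨fun z hz => ?_, h.2 _⟩
    obtain ⟨a, ha, hza⟩ := LowerSet.mem_push.1 hz
    exact LowerSet.mem_push.2 ⟨a, ha, le_trans hza (h.1 a)⟩
  lam_map s := by
    refine Preord.ext fun x =>
      FullK.ext (fun a => ?_) (ConcreteCategory.congr_hom s.comm x)
    exact LowerSet.mem_push.trans ⟨fun ⟨b, hb, h⟩ => le_trans h (s.left.hom.monotone hb),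
      fun h => ⟨x, le_refl x, h⟩⟩
  rho_map s := rfl

/-- The lax orthogonal AWFS on preorders whose left maps are the full maps and whose fibrant
objects are the complete lattices. The comultiplication is `(φ, b) ↦ (φ, (φ, b))`, the
multiplication is `(Ψ, b) ↦ (⋃ {φ | (φ, b') ∈ Ψ}, b)`. -/
def fullAWFS : AWFS Preord.{u} where
  toFunFact := fullFunFact
  sig {A B} f := Preord.ofHom
    { toFun := fun x => ⟨(x.1.1, x), fun a ha =>
        ⟨fun _ ha' => x.1.1.lower ha' ha, x.2 a ha⟩⟩
      monotone' := fun _ _ h => ⟨h.1, h⟩ }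
  pi {A B} f := Preord.ofHom
    { toFun := fun x => ⟨(FullK.join x.1.1, x.1.2), fun a ha => by
        obtain ⟨y, hy, hay⟩ := FullK.mem_join.1 ha
        exact le_trans (y.2 a hay) (x.2 y hy)⟩
      monotone' := fun x x' h => ⟨fun a ha => by
        obtain ⟨y, hy, hay⟩ := FullK.mem_join.1 ha
        exact FullK.mem_join.2 ⟨y, h.1 hy, hay⟩, h.2⟩ }
  lam_sig f := rfl
  rho_pi f := rfl
  sig_nat s := rfl
  pi_nat s := by
    refine Preord.ext fun x => FullK.ext (fun a => ?_) rfl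
    refine FullK.mem_join.trans (Iff.trans ?_ LowerSet.mem_push.symm)
    constructor
    · rintro ⟨y, hy, ha⟩
      obtain ⟨z, hz, hyz⟩ := LowerSet.mem_push.1 hy
      obtain ⟨c, hc, hac⟩ := LowerSet.mem_push.1 (hyz.1 ha)
      exact ⟨c, FullK.mem_join.2 ⟨z, hz, hc⟩, hac⟩
    · rintro ⟨c, hc, hac⟩
      obtain ⟨z, hz, hcz⟩ := FullK.mem_join.1 hc
      exact ⟨fullFunFact.map s z, LowerSet.mem_push.2 ⟨z, hz, le_rfl⟩,
        LowerSet.mem_push.2 ⟨c, hcz, hac⟩⟩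
  sig_rho f := rfl
  sig_copoint f := by
    refine Preord.ext fun x => FullK.ext (fun a => ?_) rfl
    exact LowerSet.mem_push.trans ⟨fun ⟨b, hb, h⟩ => x.1.1.lower h hb, fun h => ⟨a, h, le_rfl⟩⟩
  sig_coassoc f := by
    refine Preord.ext fun x => FullK.ext (fun a => ?_) rfl
    exact Iff.trans ⟨fun h => ⟨a, h, le_rfl⟩, fun ⟨b, hb, h⟩ => x.1.1.lower h hb⟩
      LowerSet.mem_push.symm
  lam_pi f := by
    refine Preord.ext fun x => FullK.ext (fun a => ?_) rfl
    exact FullK.mem_join.trans ⟨fun ⟨y, hy, h⟩ => hy.1 h, fun h => ⟨x, le_refl x, h⟩⟩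
  point_pi {A B} f := by
    refine Preord.ext fun x => FullK.ext (fun a => ?_) rfl
    refine FullK.mem_join.trans ⟨?_, fun h => ?_⟩
    · rintro ⟨y, hy, h⟩
      obtain ⟨b, hb, hyb⟩ := LowerSet.mem_push.1 hy
      exact x.1.1.lower (hyb.1 h) hb
    · exact ⟨fullFunFact.lam f a, LowerSet.mem_push.2 ⟨a, h, le_rfl⟩, le_refl a⟩
  pi_assoc f := by
    refine Preord.ext fun x => FullK.ext (fun a => ?_) rfl
    refine FullK.mem_join.trans (Iff.trans ?_ FullK.mem_join.symm)
    constructor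
    · rintro ⟨y, hy, h⟩
      obtain ⟨z, hz, hyz⟩ := FullK.mem_join.1 hy
      exact ⟨⟨(FullK.join z.1.1, z.1.2), _⟩, LowerSet.mem_push.2 ⟨z, hz, le_rfl⟩,
        FullK.mem_join.2 ⟨y, hyz, h⟩⟩
    · rintro ⟨y, hy, h⟩
      obtain ⟨z, hz, hyz⟩ := LowerSet.mem_push.1 hy
      obtain ⟨t, ht, hat⟩ := FullK.mem_join.1 (hyz.1 h)
      exact ⟨t, FullK.mem_join.2 ⟨z, hz, ht⟩, hat⟩
  distrib f := by
    refine Preord.ext fun x => FullK.ext (fun a => ?_) rfl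
    refine FullK.mem_join.trans (Iff.trans ?_ FullK.mem_join.symm)
    constructor
    · rintro ⟨y, hy, h⟩
      exact ⟨⟨(y.1.1, y), fun a ha => ⟨fun _ ha' => y.1.1.lower ha' ha, y.2 a ha⟩⟩,
        LowerSet.mem_push.2 ⟨y, hy, le_rfl⟩, h⟩
    · rintro ⟨y, hy, h⟩
      obtain ⟨z, hz, hyz⟩ := LowerSet.mem_push.1 hy
      exact ⟨z, hz, hyz.1 h⟩

/-- A map of preorders is full if it is full as a functor. -/
def Preord.IsFull {A B : Preord.{u}} (f : A ⟶ B) : Prop :=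
  ∀ a a' : A, f a ≤ f a' → a ≤ a'

/-- The morphism from `X` to the terminal (one-point) preorder. -/
def Preord.toOne (X : Preord.{u}) : X ⟶ Preord.of PUnit.{u + 1} :=
  Preord.ofHom ⟨fun _ => PUnit.unit, fun _ _ _ => le_rfl⟩

/-- The square from `X ⟶ 1` to `Y ⟶ 1` determined by `h : X ⟶ Y`. -/
def Preord.toOneSquare {X Y : Preord.{u}} (h : X ⟶ Y) : Square X.toOne Y.toOne :=
  ⟨h, 𝟙 _, rfl⟩

/-- A preorder is a complete lattice if it is a poset in which every subset has a supremum. -/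
def Preord.IsCompleteLattice (X : Preord.{u}) : Prop :=
  (∀ x y : X, x ≤ y → y ≤ x → x = y) ∧ ∀ s : Set X, ∃ x, IsLUB s x

/-- The chain `μ ↦ succ μ = {ν | ν ≤ μ}` of initial segments of a preorder, with the inclusions. -/
def Preord.succChain (β : Type u) [Preorder β] : β ⥤ Preord.{u} where
  obj μ := Preord.of (Set.Iic μ)
  map h := Preord.ofHom ⟨fun x => ⟨x.1, le_trans x.2 (leOfHom h)⟩, fun _ _ h => h⟩

/-- The cocone of inclusions `succ μ ⊆ β`. -/
def Preord.succCocone (β : Type u) [Preorder β] : Cocone (Preord.succChain β) where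
  pt := Preord.of β
  ι := { app := fun _ => Preord.ofHom ⟨fun x => x.1, fun _ _ h => h⟩ }

end

/-! Suppose `R`-algebras are lifting structures against a small `J`, relative to an AWFS `(E, M)`
whose functor `K` is accessible. For a regular cardinal `κ` large enough, every preorder occurring
in `J` has fewer than `κ` elements, so `C(T, -)` and `C²(i, -)` preserve `κ`-filtered unions, and so
does `K`. The `M`-algebra structures of the lifting structures therefore glue along `κ`-filtered
unions, and hence so do `R`-algebra structures. For the AWFS of full maps this is absurd: `κ` is the
`κ`-filtered union of the complete lattices `succ μ`, whose inclusions preserve suprema, but it has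
no greatest element. The same union, and the smallness of the domains of generating morphisms,
exclude generation of the underlying WFS; and the functor `K` of the AWFS of RALIs is accessible
because it has a right adjoint. -/

/-! ### Full maps and complete lattices -/

namespace AWFS

variable {C : Type w} [Category.{v} C] [PordCategory C] {W : AWFS C} {A B : C} {f : A ⟶ B}

theorem Coalg.leftClass (c : W.Coalg f) : W.leftClass f :=
  ⟨c.str, by rw [c.comm, Category.id_comp], c.counit⟩

theorem Alg.str_comp (p : W.Alg f) : p.str ≫ f = W.rho f := by
  rw [← p.comm, Category.comp_id]

theorem Alg.rightClass (p : W.Alg f) : W.rightClass f :=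
  ⟨p.str, p.unit, p.str_comp⟩

end AWFS

theorem isLUB_lowerClosure_iff {α : Type*} [Preorder α] {s : Set α} {x : α} :
    IsLUB (lowerClosure s : Set α) x ↔ IsLUB s x := by
  simp [IsLUB]

namespace fullAWFS

theorem isLaxOrthogonal : fullAWFS.{u}.IsLaxOrthogonal := by
  refine ⟨fun {A B} f => ⟨fun x => ⟨fun y hy => ?_, le_refl _⟩, le_refl _⟩,
    fun {A B} f => ⟨le_refl _, fun x => ⟨fun a ha => ?_, le_refl _⟩⟩⟩
  · obtain ⟨a, ha, hya⟩ := LowerSet.mem_push.1 hy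
    exact le_trans hya ⟨fun b hb => x.1.1.lower hb ha, x.2 a ha⟩
  · obtain ⟨b, hb, hab⟩ := LowerSet.mem_push.1 ha
    exact (x.2 b hb).1 hab

section LeftClass

variable {A B : Preord.{u}} {f : A ⟶ B}

theorem isFull_of_leftClass (hf : fullAWFS.leftClass f) : Preord.IsFull f := by
  obtain ⟨s, hs, -⟩ := hf
  intro a a' h
  have lam_le : fullAWFS.lam f a ≤ fullAWFS.lam f a' := by
    rw [← hs]
    exact s.hom.monotone h
  exact lam_le.1 (le_refl a)

/-- The coalgebra structure `b ↦ ({a | f a ≤ b}, b)` on a full map `f`. -/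
def coalgOfIsFull (hf : Preord.IsFull f) : fullAWFS.Coalg f where
  str := Preord.ofHom
    { toFun := fun b => ⟨(⟨{a | f a ≤ b}, fun _ _ h h' => le_trans (f.hom.monotone h) h'⟩, b),
        fun _ h => h⟩
      monotone' := fun _ _ h => ⟨fun _ h' => le_trans h' h, h⟩ }
  comm := Preord.ext fun a =>
    FullK.ext (fun a' => ⟨fun h => hf a' a h, fun h => f.hom.monotone h⟩) rfl
  counit := rfl
  coassoc := by
    refine Preord.ext fun b => FullK.ext (fun a => ?_) rfl
    exact Iff.trans ⟨fun h => ⟨a, h, le_rfl⟩,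
      fun ⟨c, hc, h⟩ => le_trans (f.hom.monotone h) hc⟩ LowerSet.mem_push.symm

variable (f)

theorem leftClass_iff_isFull : fullAWFS.leftClass f ↔ Preord.IsFull f :=
  ⟨isFull_of_leftClass, fun hf => (coalgOfIsFull hf).leftClass⟩

theorem nonempty_coalg_iff_isFull : Nonempty (fullAWFS.Coalg f) ↔ Preord.IsFull f :=
  ⟨fun ⟨c⟩ => isFull_of_leftClass c.leftClass, fun hf => ⟨coalgOfIsFull hf⟩⟩

end LeftClass

/-- The element `(φ, *)` of `K (X ⟶ 1)`. Every element has this form. -/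
def ofLowerSet {X : Preord.{u}} (φ : LowerSet X) : FullK X.toOne :=
  ⟨(φ, PUnit.unit), fun _ _ => le_rfl⟩

section CompleteLattice

variable {X Y : Preord.{u}}

theorem isLUB_of_lam_comp_eq_id {p : fullAWFS.K X.toOne ⟶ X}
    (hp : fullAWFS.lam X.toOne ≫ p = 𝟙 X) (φ : LowerSet X) :
    IsLUB (φ : Set X) (p (ofLowerSet φ)) := by
  have p_Iic (a : X) : p (ofLowerSet (LowerSet.Iic a)) = a := ConcreteCategory.congr_hom hp a
  refine ⟨fun a ha => ?_, fun b hb => ?_⟩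
  · have h : ofLowerSet (LowerSet.Iic a) ≤ ofLowerSet φ :=
      ⟨fun c hc => φ.lower (show c ≤ a from hc) ha, le_rfl⟩
    simpa only [p_Iic] using p.hom.monotone h
  · have h : ofLowerSet φ ≤ ofLowerSet (LowerSet.Iic b) := ⟨fun c hc => hb hc, le_rfl⟩
    simpa only [p_Iic] using p.hom.monotone h

theorem isCompleteLattice_of_rightClass (h : fullAWFS.rightClass X.toOne) :
    X.IsCompleteLattice := by
  obtain ⟨p, hp, -⟩ := h
  refine ⟨fun x y hxy hyx => ?_,
    fun s => ⟨_, isLUB_lowerClosure_iff.1 (isLUB_of_lam_comp_eq_id hp _)⟩⟩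
  have lam_injective : Function.Injective (fullAWFS.lam X.toOne) :=
    Function.LeftInverse.injective (g := p) (ConcreteCategory.congr_hom hp)
  exact lam_injective (FullK.ext (fun a => ⟨fun h => le_trans (show a ≤ x from h) hxy,
    fun h => le_trans (show a ≤ y from h) hyx⟩) rfl)

theorem isLUB_unique (hX : X.IsCompleteLattice) {s : Set X} {x y : X} (hx : IsLUB s x)
    (hy : IsLUB s y) : x = y :=
  hX.1 _ _ (hx.2 hy.1) (hy.2 hx.1)

/-- The algebra structure on a complete lattice given by suprema. -/
noncomputable def algOfIsCompleteLattice (hX : X.IsCompleteLattice) : fullAWFS.Alg X.toOne where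
  str := Preord.ofHom
    { toFun := fun x => (hX.2 (x.1.1 : Set X)).choose
      monotone' := fun x y h => (hX.2 (x.1.1 : Set X)).choose_spec.2
        fun _ ha => (hX.2 (y.1.1 : Set X)).choose_spec.1 (h.1 ha) }
  comm := rfl
  unit := Preord.ext fun a =>
    isLUB_unique hX (hX.2 (LowerSet.Iic a : Set X)).choose_spec isLUB_Iic
  assoc := by
    refine Preord.ext fun x => isLUB_unique hX (hX.2 _).choose_spec ?_
    refine isLUB_lowerClosure_iff.2 ⟨?_, fun b hb => ?_⟩
    · rintro _ ⟨y, hy, rfl⟩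
      exact (hX.2 _).choose_spec.2 fun a ha =>
        (hX.2 _).choose_spec.1 (FullK.mem_join.2 ⟨y, hy, ha⟩)
    · refine (hX.2 _).choose_spec.2 fun a ha => ?_
      obtain ⟨y, hy, hay⟩ := FullK.mem_join.1 ha
      exact le_trans ((hX.2 (y.1.1 : Set X)).choose_spec.1 hay) (hb ⟨y, hy, rfl⟩)

variable (X) in
theorem rightClass_toOne_iff : fullAWFS.rightClass X.toOne ↔ X.IsCompleteLattice :=
  ⟨isCompleteLattice_of_rightClass, fun hX => (algOfIsCompleteLattice hX).rightClass⟩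

variable (X) in
theorem nonempty_alg_toOne_iff : Nonempty (fullAWFS.Alg X.toOne) ↔ X.IsCompleteLattice :=
  ⟨fun ⟨p⟩ => isCompleteLattice_of_rightClass p.rightClass,
    fun hX => ⟨algOfIsCompleteLattice hX⟩⟩

theorem isAlgHom_toOneSquare_iff (p : fullAWFS.Alg X.toOne) (q : fullAWFS.Alg Y.toOne)
    (h : X ⟶ Y) :
    AWFS.IsAlgHom p q (Preord.toOneSquare h) ↔
      ∀ (s : Set X) (x : X), IsLUB s x → IsLUB (h '' s) (h x) := by
  have hX := isCompleteLattice_of_rightClass p.rightClass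
  have hY := isCompleteLattice_of_rightClass q.rightClass
  have isLUB_p (φ : LowerSet X) : IsLUB (φ : Set X) (p.str (ofLowerSet φ)) :=
    isLUB_of_lam_comp_eq_id p.unit φ
  have isLUB_q (φ : LowerSet X) :
      IsLUB (h '' φ) (q.str (fullAWFS.map (Preord.toOneSquare h) (ofLowerSet φ))) :=
    isLUB_lowerClosure_iff.1 (isLUB_of_lam_comp_eq_id q.unit (LowerSet.push h φ))
  refine ⟨fun hpq s x hx => ?_, fun hh => Preord.ext fun x =>
    isLUB_unique hY (hh _ _ (isLUB_p x.1.1)) (isLUB_q x.1.1)⟩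
  obtain rfl : p.str (ofLowerSet (lowerClosure s)) = x :=
    isLUB_unique hX (isLUB_p _) (isLUB_lowerClosure_iff.2 hx)
  have isLUB_image : IsLUB (h '' lowerClosure s) (h (p.str (ofLowerSet (lowerClosure s)))) := by
    rw [show h (p.str _) = q.str _ from ConcreteCategory.congr_hom hpq (ofLowerSet _)]
    exact isLUB_q _
  refine ⟨fun _ ⟨a, ha, e⟩ => isLUB_image.1 ⟨a, subset_lowerClosure ha, e⟩,
    fun b hb => isLUB_image.2 ?_⟩
  rintro _ ⟨a, ⟨c, hc, hac⟩, rfl⟩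
  exact le_trans (h.hom.monotone hac) (hb ⟨c, hc, rfl⟩)

end CompleteLattice

end fullAWFS

/-! ### Morphisms of algebras -/

namespace AWFS

variable {C : Type w} [Category.{v} C] [PordCategory C] {W : AWFS C}

theorem IsAlgHom.w {A B X Y : C} {f : A ⟶ B} {g : X ⟶ Y} {p : W.Alg f} {q : W.Alg g}
    {s : Square f g} (hs : IsAlgHom p q s) : p.str ≫ s.left = W.map s ≫ q.str :=
  hs

theorem IsAlgHom.comp {A B X Y Z T : C} {f : A ⟶ B} {g : X ⟶ Y} {h : Z ⟶ T} {p : W.Alg f}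
    {q : W.Alg g} {r : W.Alg h} {s : Square f g} {t : Square g h} (hs : IsAlgHom p q s)
    (ht : IsAlgHom q r t) : IsAlgHom p r (s.comp t) := by
  rw [IsAlgHom, Square.comp_left, ← Category.assoc, hs.w, Category.assoc, ht.w, map_map_assoc]

theorem IsAlgHom.eq_of_id {A B : C} {f : A ⟶ B} {p q : W.Alg f}
    (h : IsAlgHom p q (Square.id f)) : p = q :=
  Alg.ext (by simpa only [W.map_id, Square.id_left, Category.comp_id, Category.id_comp] using h.w)

theorem isAlgHom_cast {A B X Y : C} {f f' : A ⟶ B} {g g' : X ⟶ Y} (hf : f = f') (hg : g = g')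
    {p : W.Alg f} {q : W.Alg g} {s : Square f g} (hs : IsAlgHom p q s) (s' : Square f' g')
    (hl : s'.left = s.left) (hr : s'.right = s.right) : IsAlgHom (hf ▸ p) (hg ▸ q) s' := by
  subst hf hg
  obtain rfl : s' = s := Square.ext hl hr
  exact hs

theorem isAlgHom_comp {A B Y A' B' Y' : C} {f : A ⟶ B} {g : B ⟶ Y} {f' : A' ⟶ B'}
    {g' : B' ⟶ Y'} {p : W.Alg f} {q : W.Alg g} {p' : W.Alg f'} {q' : W.Alg g'}
    {s : Square f f'} {t : Square g g'} (hp : IsAlgHom p p' s) (hq : IsAlgHom q q' t)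
    (hst : s.right = t.left) (r : Square (f ≫ g) (f' ≫ g')) (hl : r.left = s.left)
    (hr : r.right = t.right) : IsAlgHom (p.comp q) (p'.comp q') r := by
  have compSquare_natural :
      (Alg.compSquare (f := f) q).comp s = (W.mapL r).comp (Alg.compSquare (f := f') q') := by
    ext
    · simp only [Square.comp_left, Alg.compSquare, FunFact.mapL, Category.id_comp,
        Category.comp_id, hl]
    · simp only [Square.comp_right, Alg.compSquare, FunFact.mapL]
      rw [Category.assoc, hst, hq.w, map_map_assoc, map_map_assoc]
      congr 2
      ext
      · simp only [Square.comp_left]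
        rw [← hst, s.comm, hl]
      · simp only [Square.comp_right, Category.id_comp, Category.comp_id, hr]
  change (W.sig (f ≫ g) ≫ W.map q.compSquare ≫ p.str) ≫ r.left =
    W.map r ≫ W.sig (f' ≫ g') ≫ W.map q'.compSquare ≫ p'.str
  rw [map_sig_assoc, map_map_assoc, Category.assoc, Category.assoc, hl, hp.w, map_map_assoc,
    compSquare_natural]

theorem isAlgHom_pullback {A B X Y A' B' X' Y' : C} {f : A ⟶ B} {g : X ⟶ Y}
    {f' : A' ⟶ B'} {g' : X' ⟶ Y'} {q : W.Alg g} {q' : W.Alg g'} {h : A ⟶ X} {k : B ⟶ Y}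
    {h' : A' ⟶ X'} {k' : B' ⟶ Y'} (sq : IsPullback h f g k) (sq' : IsPullback h' f' g' k')
    {t : Square g g'} (ht : IsAlgHom q q' t) (s : Square f f') (hl : s.left ≫ h' = h ≫ t.left)
    (hr : s.right ≫ k' = k ≫ t.right) : IsAlgHom (q.pullback sq) (q'.pullback sq') s := by
  have hom_h : (q.pullback sq).str ≫ h = _ := (q.pullback_isAlgHom sq).w
  have hom_h' : (q'.pullback sq').str ≫ h' = _ := (q'.pullback_isAlgHom sq').w
  apply sq'.hom_ext
  · rw [Category.assoc, Category.assoc, hl, hom_h', ← Category.assoc, hom_h, Category.assoc, ht.w,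
      map_map_assoc, map_map_assoc]
    congr 2
    ext
    · exact hl.symm
    · exact hr.symm
  · rw [Category.assoc, Category.assoc, ← s.comm, ← Category.assoc, Alg.str_comp, Alg.str_comp,
      W.rho_map]

end AWFS

section Lifting

variable {C : Type w} [Category.{u} C] [PordCategory C] {EM : AWFS Preord.{u}}

theorem AWFS.isAlgHom_compLeft {S T Z X Y X' Y' : C} {i : S ⟶ T} {j : T ⟶ Z} {g : X ⟶ Y}
    {g' : X' ⟶ Y'} {φ : EM.Alg (liftMap i g)} {γ : EM.Alg (liftMap j g)}
    {φ' : EM.Alg (liftMap i g')} {γ' : EM.Alg (liftMap j g')} {s : Square g g'}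
    (hφ : AWFS.IsAlgHom φ φ' (liftMapPost i s)) (hγ : AWFS.IsAlgHom γ γ' (liftMapPost j s)) :
    AWFS.IsAlgHom (φ.compLeft γ) (φ'.compLeft γ') (liftMapPost (i ≫ j) s) := by
  have post_pre : Square.post j s ≫ (Square.drop i j).pre g' =
      (Square.drop i j).pre g ≫ Square.post (i ≫ j) s :=
    Preord.ext fun t => Square.ext (Category.assoc _ _ _).symm (Category.assoc _ _ _).symm
  have post_extend : Square.post (i ≫ j) s ≫ (Square.extend i j).pre g' =
      (Square.extend i j).pre g ≫ Square.post i s :=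
    Preord.ext fun t => Square.ext (Category.assoc _ _ _).symm (Category.assoc _ _ _).symm
  let r : Square (liftMap j g ≫ (Square.drop i j).pre g)
      (liftMap j g' ≫ (Square.drop i j).pre g') :=
    ⟨(liftMapPost j s).left, Square.post (i ≫ j) s, by
      rw [Category.assoc, ← post_pre]
      exact (liftMapPost j s).comm =≫ (Square.drop i j).pre g'⟩
  refine AWFS.isAlgHom_cast (liftMap_comp_left i j g) (liftMap_comp_left i j g') (s := r) ?_ _
    rfl rfl
  exact AWFS.isAlgHom_comp (t := ⟨_, _, post_pre.symm⟩) hγ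
    (AWFS.isAlgHom_pullback _ _ hφ _ rfl post_extend) rfl _ rfl rfl

theorem AWFS.isAlgHom_liftMapPost_cast {S T X Y X' Y' : C} {i j : S ⟶ T} (h : i = j) {g : X ⟶ Y}
    {g' : X' ⟶ Y'} {p : EM.Alg (liftMap i g)} {q : EM.Alg (liftMap i g')} {s : Square g g'}
    (hs : AWFS.IsAlgHom p q (liftMapPost i s)) :
    AWFS.IsAlgHom (h ▸ p : EM.Alg (liftMap j g)) (h ▸ q : EM.Alg (liftMap j g'))
      (liftMapPost j s) := by
  subst h
  exact hs

end Lifting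

/-! ### Algebras on colimits of arrows -/

/-- The commutative square underlying a morphism of arrows. -/
def Square.ofArrowHom {C : Type w} [Category.{v} C] {f g : Arrow C} (s : f ⟶ g) :
    Square f.hom g.hom :=
  ⟨s.left, s.right, (Arrow.w s).symm⟩

/-- The commutative square underlying a leg of a cocone of arrows. -/
def Square.ofCocone {C : Type w} [Category.{v} C] {J : Type*} [Category* J] {F : J ⥤ Arrow C}
    (c : Cocone F) (j : J) : Square (F.obj j).hom c.pt.hom :=
  Square.ofArrowHom (c.ι.app j)

namespace AWFS

variable {C : Type w} [Category.{v} C] [PordCategory C] {W : AWFS C}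

variable (W) in
/-- The underlying endofunctor `R : C² ⥤ C²`, `f ↦ rho f`, of the monad of an AWFS. -/
def rightFunctor : Arrow C ⥤ Arrow C where
  obj f := Arrow.mk (W.rho f.hom)
  map s := Arrow.homMk (W.functor.map s) s.right (W.rho_map (Square.ofArrowHom s)).symm
  map_id f := by
    ext
    · exact W.functor.map_id f
    · rfl
  map_comp s t := by
    ext
    · exact W.functor.map_comp s t
    · rfl

section Colimit

variable {J : Type*} [Category* J] [PreservesColimitsOfShape J W.functor] {F : J ⥤ Arrow C}
  {c : Cocone F} (hl : IsColimit (Arrow.leftFunc.mapCocone c))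
  (hr : IsColimit (Arrow.rightFunc.mapCocone c))

variable (W) in
/-- The value of `K` at a colimit of arrows formed separately on domains and codomains. -/
noncomputable def isColimitMapCocone : IsColimit (W.functor.mapCocone c) :=
  isColimitOfPreserves W.functor (Comma.fstSndJointlyReflectColimit hl hr)

include hl hr in
theorem IsAlgHom.of_isColimit {X Y : C} {g : X ⟶ Y} {p : ∀ j, W.Alg (F.obj j).hom}
    {q : W.Alg c.pt.hom} (hq : ∀ j, IsAlgHom (p j) q (Square.ofCocone c j))
    {r : W.Alg g} {s : Square c.pt.hom g}
    (hs : ∀ j, IsAlgHom (p j) r ((Square.ofCocone c j).comp s)) : IsAlgHom q r s := by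
  refine (isColimitMapCocone W hl hr).hom_ext fun j => ?_
  change W.map (Square.ofCocone c j) ≫ _ = W.map (Square.ofCocone c j) ≫ _
  rw [← Category.assoc, ← (hq j).w, map_map_assoc, ← (hs j).w, Square.comp_left, Category.assoc]

variable {p : ∀ j, W.Alg (F.obj j).hom}
  (hp : ∀ {j k : J} (m : j ⟶ k), IsAlgHom (p j) (p k) (Square.ofArrowHom (F.map m)))

/-- The cocone of the composites of the structure maps of a compatible family of algebras with
the domains of the legs of a cocone. -/
def Alg.strCocone (c : Cocone F) : Cocone (F ⋙ W.functor) where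
  pt := c.pt.left
  ι :=
    { app := fun j => (p j).str ≫ (c.ι.app j).left
      naturality := fun j k m => by
        change W.map (Square.ofArrowHom (F.map m)) ≫ (p k).str ≫ (c.ι.app k).left =
          ((p j).str ≫ (c.ι.app j).left) ≫ 𝟙 _
        rw [← Category.assoc, ← (hp m).w, Category.comp_id, Category.assoc]
        exact (p j).str ≫= (Arrow.leftFunc.mapCocone c).w m }

/-- The structure map of the algebra on a colimit of arrows induced by a compatible family. -/
noncomputable def Alg.colimitStr : W.K c.pt.hom ⟶ c.pt.left :=
  (isColimitMapCocone W hl hr).desc (strCocone hp c)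

theorem Alg.map_colimitStr (j : J) :
    W.map (Square.ofCocone c j) ≫ colimitStr hl hr hp =
      (p j).str ≫ (c.ι.app j).left :=
  (isColimitMapCocone W hl hr).fac (strCocone hp c) j

theorem Alg.colimitStr_comp : colimitStr hl hr hp ≫ c.pt.hom = W.rho c.pt.hom := by
  refine (isColimitMapCocone W hl hr).hom_ext fun j => ?_
  change W.map (Square.ofCocone c j) ≫ _ = W.map (Square.ofCocone c j) ≫ _
  calc W.map (Square.ofCocone c j) ≫ colimitStr hl hr hp ≫ c.pt.hom
      = ((p j).str ≫ (c.ι.app j).left) ≫ c.pt.hom := by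
        rw [← Category.assoc, map_colimitStr]
    _ = (p j).str ≫ (F.obj j).hom ≫ (c.ι.app j).right := by
        rw [Category.assoc]
        exact (p j).str ≫= Arrow.w (c.ι.app j)
    _ = W.rho (F.obj j).hom ≫ (c.ι.app j).right := by
        rw [← Category.assoc, (p j).str_comp]
    _ = W.map (Square.ofCocone c j) ≫ W.rho c.pt.hom :=
        W.rho_map (Square.ofCocone c j)

theorem Alg.lam_colimitStr : W.lam c.pt.hom ≫ colimitStr hl hr hp = 𝟙 c.pt.left := by
  refine hl.hom_ext fun j => ?_
  change (Square.ofCocone c j).left ≫ _ = (Square.ofCocone c j).left ≫ _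
  rw [← Category.assoc, ← W.lam_map, Category.assoc, map_colimitStr, ← Category.assoc, (p j).unit,
    Category.id_comp, Category.comp_id]
  rfl

/-- The algebra structure on a colimit of arrows induced by a compatible family. -/
noncomputable def Alg.ofIsColimit : W.Alg c.pt.hom where
  str := colimitStr hl hr hp
  comm := (Category.comp_id _).trans (colimitStr_comp hl hr hp).symm
  unit := lam_colimitStr hl hr hp
  assoc := by
    refine (isColimitMapCocone W (c := W.rightFunctor.mapCocone c)
      (isColimitMapCocone W hl hr) hr).hom_ext fun j => ?_
    let s := Square.ofCocone c j
    have hs : W.map s ≫ colimitStr hl hr hp = (p j).str ≫ s.left := map_colimitStr hl hr hp j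
    change W.map (W.mapR s) ≫ _ ≫ _ = W.map (W.mapR s) ≫ W.pi c.pt.hom ≫ _
    rw [← Category.assoc _ (W.pi _), W.pi_nat, Category.assoc, hs, ← Category.assoc (W.pi _),
      ← (p j).assoc, Category.assoc, ← hs, map_map_assoc, map_map_assoc]
    congr 2
    ext1
    · exact hs
    · exact (Category.comp_id _).trans (Category.id_comp _).symm

theorem isAlgHom_ofIsColimit (j : J) :
    IsAlgHom (p j) (Alg.ofIsColimit hl hr hp) (Square.ofCocone c j) :=
  (Alg.map_colimitStr hl hr hp j).symm

end Colimit

end AWFS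

/-! ### Lifting structures on colimits of arrows -/

section LiftingColimit

variable {C : Type w} [Category.{u} C] [PordCategory C]

/-- The functor `g ↦ liftMap i g`. -/
def liftFunctor {S T : C} (i : S ⟶ T) : Arrow C ⥤ Arrow Preord.{u} where
  obj g := Arrow.mk (liftMap i g.hom)
  map s := Arrow.homMk (liftMapPost i (Square.ofArrowHom s)).left
    (liftMapPost i (Square.ofArrowHom s)).right (liftMapPost i (Square.ofArrowHom s)).comm.symm
  map_id g := by
    ext d
    · exact Category.comp_id _
    · exact Square.ext (Category.comp_id _) (Category.comp_id _)
  map_comp s t := by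
    ext d
    · exact (Category.assoc _ _ _).symm
    · exact Square.ext (Category.assoc _ _ _).symm (Category.assoc _ _ _).symm

theorem liftMapPost_comp_liftMapPre {S T S' T' X Y X' Y' : C} {i : S ⟶ T} {i' : S' ⟶ T'}
    {g : X ⟶ Y} {g' : X' ⟶ Y'} (t : Square i i') (s : Square g g') :
    (liftMapPost i' s).comp (liftMapPre t g') = (liftMapPre t g).comp (liftMapPost i s) := by
  ext d <;> exact (Category.assoc _ _ _).symm

namespace LiftStr

variable {EM : AWFS Preord.{u}} {J : PordDouble.{u}} {U : J.ToSq C}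

/-- The square `s` is a morphism of lifting structures against `J`. -/
def IsHom {A B X Y : C} {f : A ⟶ B} {g : X ⟶ Y} (l : LiftStr EM U f) (l' : LiftStr EM U g)
    (s : Square f g) : Prop :=
  ∀ {a b : J.Obj} (i : J.Vert a b), AWFS.IsAlgHom (l.alg i) (l'.alg i) (liftMapPost (U.vert i) s)

variable {D : Type*} [Category* D] [PreservesColimitsOfShape D EM.functor] {F : D ⥤ Arrow C}
  {c : Cocone F}
  (hl : ∀ {a b : J.Obj} (i : J.Vert a b),
    IsColimit (Arrow.leftFunc.mapCocone ((liftFunctor (U.vert i)).mapCocone c)))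
  (hr : ∀ {a b : J.Obj} (i : J.Vert a b),
    IsColimit (Arrow.rightFunc.mapCocone ((liftFunctor (U.vert i)).mapCocone c)))
  {l : ∀ d, LiftStr EM U (F.obj d).hom}
  (h : ∀ {d d' : D} (m : d ⟶ d'), (l d).IsHom (l d') (Square.ofArrowHom (F.map m)))

/-- The algebra structure on `liftMap i c.pt.hom` glued from those of the lifting structures
`l d`. -/
noncomputable def colimitAlg {a b : J.Obj} (i : J.Vert a b) :
    EM.Alg (liftMap (U.vert i) c.pt.hom) :=
  AWFS.Alg.ofIsColimit (p := fun d => (l d).alg i) (hl i) (hr i) fun m => h m i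

theorem isAlgHom_colimitAlg {a b : J.Obj} (i : J.Vert a b) (d : D) :
    AWFS.IsAlgHom ((l d).alg i) (colimitAlg hl hr h i)
      (liftMapPost (U.vert i) (Square.ofCocone c d)) :=
  AWFS.isAlgHom_ofIsColimit (p := fun d => (l d).alg i) (hl i) (hr i) (fun m => h m i) d

theorem colimitAlg_natural {a b a' b' : J.Obj} {i : J.Vert a b} {j : J.Vert a' b'} {x : a ⟶ a'}
    {y : b ⟶ b'} (σ : J.Cell i j x y) :
    AWFS.IsAlgHom (colimitAlg hl hr h j) (colimitAlg hl hr h i)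
      (liftMapPre (⟨U.obj.map x, U.obj.map y, U.cell σ⟩ : Square (U.vert i) (U.vert j))
        c.pt.hom) := by
  refine AWFS.IsAlgHom.of_isColimit (hl j) (hr j) (isAlgHom_colimitAlg hl hr h j) fun d => ?_
  have legs_natural := ((l d).natural σ).comp (isAlgHom_colimitAlg hl hr h i d)
  rwa [← liftMapPost_comp_liftMapPre] at legs_natural

theorem colimitAlg_vComp {a b b' : J.Obj} (i : J.Vert a b) (j : J.Vert b b') :
    (U.vert_comp i j ▸ colimitAlg hl hr h (J.vComp i j) :
      EM.Alg (liftMap (U.vert i ≫ U.vert j) c.pt.hom)) =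
      (colimitAlg hl hr h i).compLeft (colimitAlg hl hr h j) := by
  have hl_comp : IsColimit
      (Arrow.leftFunc.mapCocone ((liftFunctor (U.vert i ≫ U.vert j)).mapCocone c)) :=
    U.vert_comp i j ▸ hl (J.vComp i j)
  have hr_comp : IsColimit
      (Arrow.rightFunc.mapCocone ((liftFunctor (U.vert i ≫ U.vert j)).mapCocone c)) :=
    U.vert_comp i j ▸ hr (J.vComp i j)
  have legs_vComp (d : D) := AWFS.isAlgHom_liftMapPost_cast (U.vert_comp i j)
    (isAlgHom_colimitAlg hl hr h (J.vComp i j) d)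
  have legs_compLeft (d : D) := AWFS.isAlgHom_compLeft (isAlgHom_colimitAlg hl hr h i d)
    (isAlgHom_colimitAlg hl hr h j d)
  refine AWFS.IsAlgHom.eq_of_id (AWFS.IsAlgHom.of_isColimit hl_comp hr_comp legs_vComp fun d => ?_)
  rw [(l d).comp]
  exact legs_compLeft d

/-- The lifting structure on a colimit of arrows glued from a compatible family. -/
noncomputable def ofIsColimit : LiftStr EM U c.pt.hom where
  alg := colimitAlg hl hr h
  natural := colimitAlg_natural hl hr h
  comp := colimitAlg_vComp hl hr h

end LiftStr

end LiftingColimit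

/-! ### Unions of preorders -/

section Union

variable {J : Type w} [Category.{v} J] {F : J ⥤ Preord.{u}} {c : Cocone F}

/-- The cocone `c` exhibits its vertex as the union of the preorders `F j`: its legs are embeddings
and jointly surjective. -/
structure IsUnion (c : Cocone F) : Prop where
  injective : ∀ j, Function.Injective (c.ι.app j)
  full : ∀ j, Preord.IsFull (c.ι.app j)
  exists_eq : ∀ z : c.pt, ∃ j x, c.ι.app j x = z

namespace IsUnion

theorem hom_ext (hc : IsUnion c) (j : J) {S : Preord.{u}} {g g' : S ⟶ F.obj j}
    (h : g ≫ c.ι.app j = g' ≫ c.ι.app j) : g = g' :=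
  Preord.ext fun s => hc.injective j (ConcreteCategory.congr_hom h s)

section Filtered

variable [IsFiltered J]

open IsFiltered

theorem le_of_le (hc : IsUnion c) (s : Cocone F) {j k : J} {x : F.obj j} {y : F.obj k}
    (h : c.ι.app j x ≤ c.ι.app k y) : s.ι.app j x ≤ s.ι.app k y := by
  have map_le_map : F.map (leftToMax j k) x ≤ F.map (rightToMax j k) y :=
    hc.full _ _ _ (by rwa [Cocone.w_apply, Cocone.w_apply])
  simpa only [Cocone.w_apply] using (s.ι.app (max j k)).hom.monotone map_le_map

theorem eq_of_eq (hc : IsUnion c) (s : Cocone F) {j k : J} {x : F.obj j} {y : F.obj k}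
    (h : c.ι.app j x = c.ι.app k y) : s.ι.app j x = s.ι.app k y := by
  have map_eq_map : F.map (leftToMax j k) x = F.map (rightToMax j k) y :=
    hc.injective _ (by rwa [Cocone.w_apply, Cocone.w_apply])
  simpa only [Cocone.w_apply] using congrArg (s.ι.app (max j k)) map_eq_map

/-- The universal property of a filtered union. -/
noncomputable def isColimit (hc : IsUnion c) : IsColimit c := by
  choose d x hx using hc.exists_eq
  exact
    { desc s := Preord.ofHom
        ⟨fun z => s.ι.app (d z) (x z), fun z z' h => hc.le_of_le s (by rwa [hx, hx])⟩
      fac s j := Preord.ext fun y => hc.eq_of_eq s (hx _)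
      uniq s m hm := Preord.ext fun z => by
        rw [← hx z]
        exact (ConcreteCategory.congr_hom (hm (d z)) (x z)).trans (hc.eq_of_eq s (hx _).symm) }

end Filtered

variable {κ : Cardinal.{u}} [Fact κ.IsRegular] [IsCardinalFiltered J κ]

theorem exists_comp_eq (hc : IsUnion c) {S : Preord.{u}} (hS : HasCardinalLT S κ)
    (f : S ⟶ c.pt) : ∃ (j : J) (g : S ⟶ F.obj j), g ≫ c.ι.app j = f := by
  choose d x hx using fun s => hc.exists_eq (f s)
  let m := IsCardinalFiltered.toMax d hS
  have app_map (s : S) : c.ι.app _ (F.map (m s) (x s)) = f s :=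
    (Cocone.w_apply c (m s) (x s)).trans (hx s)
  refine ⟨_, Preord.ofHom ⟨fun s => F.map (m s) (x s), fun s t hst => hc.full _ _ _ ?_⟩,
    Preord.ext app_map⟩
  rw [app_map, app_map]
  exact f.hom.monotone hst

end IsUnion

end Union

section HomUnion

variable {D : Type w} [Category.{v} D] {F : D ⥤ Arrow Preord.{u}} {c : Cocone F}
  {κ : Cardinal.{u}} [Fact κ.IsRegular] [IsCardinalFiltered D κ] {S T : Preord.{u}} (i : S ⟶ T)

theorem isUnion_leftFunc_liftFunctor (hl : IsUnion (Arrow.leftFunc.mapCocone c))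
    (hT : HasCardinalLT T κ) :
    IsUnion (Arrow.leftFunc.mapCocone ((liftFunctor i).mapCocone c)) where
  injective j _ _ h := hl.hom_ext j h
  full j _ _ h t := hl.full j _ _ (h t)
  exists_eq f := hl.exists_comp_eq hT f

theorem isUnion_rightFunc_liftFunctor (hl : IsUnion (Arrow.leftFunc.mapCocone c))
    (hr : IsUnion (Arrow.rightFunc.mapCocone c)) (hS : HasCardinalLT S κ)
    (hT : HasCardinalLT T κ) :
    IsUnion (Arrow.rightFunc.mapCocone ((liftFunctor i).mapCocone c)) where
  injective j _ _ h := Square.ext (hl.hom_ext j (congrArg Square.left h))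
    (hr.hom_ext j (congrArg Square.right h))
  full j _ _ h := ⟨fun s => hl.full j _ _ (h.1 s), fun t => hr.full j _ _ (h.2 t)⟩
  exists_eq := by
    have := isFiltered_of_isCardinalFiltered D κ
    intro (t : Square i c.pt.hom)
    obtain ⟨j, a, ha⟩ := hl.exists_comp_eq hS t.left
    obtain ⟨k, b, hb⟩ := hr.exists_comp_eq hT t.right
    let m := IsFiltered.leftToMax j k
    let n := IsFiltered.rightToMax j k
    let g := a ≫ (F.map m).left
    let h := b ≫ (F.map n).right
    have hg : g ≫ (c.ι.app (IsFiltered.max j k)).left = t.left :=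
      (Category.assoc _ _ _).trans ((congrArg (a ≫ ·) ((Arrow.leftFunc.mapCocone c).w m)).trans ha)
    have hh : h ≫ (c.ι.app (IsFiltered.max j k)).right = t.right :=
      (Category.assoc _ _ _).trans ((congrArg (b ≫ ·) ((Arrow.rightFunc.mapCocone c).w n)).trans hb)
    refine ⟨IsFiltered.max j k, ⟨g, h, hr.hom_ext _ ?_⟩, Square.ext hg hh⟩
    change (i ≫ h) ≫ (c.ι.app _).right = (g ≫ (F.obj _).hom) ≫ (c.ι.app _).right
    rw [Category.assoc, hh, t.comm, Category.assoc, ← Arrow.w, ← Category.assoc, hg]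
    rfl

end HomUnion

/-! ### Right classes of generated systems are closed under unions -/

namespace AWFS

variable {W : AWFS Preord.{u}} {D : Type u} [SmallCategory D] {κ : Cardinal.{u}}
  [Fact κ.IsRegular] [IsCardinalFiltered D κ]

theorem IsGeneratedBy.nonempty_alg_of_isUnion {EM : AWFS Preord.{u}}
    [EM.functor.IsCardinalAccessible κ] {J : PordDouble.{u}} {U : J.ToSq Preord.{u}}
    (hW : W.IsGeneratedBy EM U) (hU : ∀ a, HasCardinalLT (U.obj.obj a) κ)
    {F : D ⥤ Arrow Preord.{u}} {c : Cocone F} (hl : IsUnion (Arrow.leftFunc.mapCocone c))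
    (hr : IsUnion (Arrow.rightFunc.mapCocone c)) (p : ∀ d, W.Alg (F.obj d).hom)
    (hp : ∀ {d d' : D} (m : d ⟶ d'), IsAlgHom (p d) (p d') (Square.ofArrowHom (F.map m))) :
    Nonempty (W.Alg c.pt.hom) := by
  obtain ⟨e, isAlgHom_iff, -⟩ := hW
  have := isFiltered_of_isCardinalFiltered D κ
  have := EM.functor.preservesColimitsOfShape_of_isCardinalAccessible κ D
  exact ⟨(e c.pt.hom).symm <| LiftStr.ofIsColimit (l := fun d => e _ (p d))
    (fun i => (isUnion_leftFunc_liftFunctor (U.vert i) hl (hU _)).isColimit)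
    (fun i => (isUnion_rightFunc_liftFunctor (U.vert i) hl hr (hU _) (hU _)).isColimit)
    fun m => (isAlgHom_iff _ _ _).1 (hp m)⟩

theorem IsCofibrantlyGenerated.exists_nonempty_alg_of_isUnion {EM : AWFS Preord.{u}}
    [EM.functor.IsAccessible.{u}] (hW : W.IsCofibrantlyGenerated EM) :
    ∃ (κ : Cardinal.{u}) (_ : Fact κ.IsRegular), ∀ {D : Type u} [SmallCategory D]
      [IsCardinalFiltered D κ] {F : D ⥤ Arrow Preord.{u}} {c : Cocone F}
      (_ : IsUnion (Arrow.leftFunc.mapCocone c)) (_ : IsUnion (Arrow.rightFunc.mapCocone c))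
      (p : ∀ d, W.Alg (F.obj d).hom)
      (_ : ∀ {d d' : D} (m : d ⟶ d'),
        IsAlgHom (p d) (p d') (Square.ofArrowHom (F.map m))),
      Nonempty (W.Alg c.pt.hom) := by
  obtain ⟨J, U, hU⟩ := hW
  obtain ⟨κ₀, _, _⟩ := Functor.IsAccessible.exists_cardinal (F := EM.functor)
  obtain ⟨κ₁, hκ₁, hlt⟩ := HasCardinalLT.exists_regular_cardinal_forall.{u}
    fun a => (U.obj.obj a : Type u)
  have : Fact (κ₀ ⊔ κ₁).IsRegular := ⟨iteInduction (fun _ => hκ₁) fun _ => Fact.out⟩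
  have := EM.functor.isCardinalAccessible_of_le (le_sup_left : κ₀ ≤ κ₀ ⊔ κ₁)
  refine ⟨κ₀ ⊔ κ₁, inferInstance, fun hl hr p hp => ?_⟩
  exact hU.nonempty_alg_of_isUnion (κ := κ₀ ⊔ κ₁) (fun a => (hlt a).of_le le_sup_right) hl hr p hp

end AWFS

theorem hasLiftingProperty_of_isUnion {J : Type w} [Category.{v} J] {F : J ⥤ Preord.{u}}
    {c : Cocone F} {κ : Cardinal.{u}} [Fact κ.IsRegular] [IsCardinalFiltered J κ] (hc : IsUnion c)
    {S T Y : Preord.{u}} {i : S ⟶ T} (hS : HasCardinalLT S κ) {p : c.pt ⟶ Y}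
    (h : ∀ j, HasLiftingProperty i (c.ι.app j ≫ p)) : HasLiftingProperty i p where
  sq_hasLift {f g} sq := by
    obtain ⟨j, f', rfl⟩ := hc.exists_comp_eq hS f
    have sq' : CommSq f' i (c.ι.app j ≫ p) g := ⟨by rw [← Category.assoc, sq.w]⟩
    exact ⟨⟨⟨sq'.lift ≫ c.ι.app j, by rw [← Category.assoc, sq'.fac_left],
      by rw [Category.assoc, sq'.fac_right]⟩⟩⟩

theorem AWFS.IsWFSCofibrantlyGenerated.exists_rightClass_of_isUnion {W : AWFS Preord.{u}}
    (hW : W.IsWFSCofibrantlyGenerated) :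
    ∃ (κ : Cardinal.{u}) (_ : Fact κ.IsRegular), ∀ {J : Type w} [Category.{v} J]
      [IsCardinalFiltered J κ] {F : J ⥤ Preord.{u}} {c : Cocone F} (_ : IsUnion c)
      {Y : Preord.{u}} {p : c.pt ⟶ Y} (_ : ∀ j, W.rightClass (c.ι.app j ≫ p)),
      W.rightClass p := by
  obtain ⟨I, hI, rightClass_eq⟩ := hW
  have : Small.{u} I.toSet := hI.small_toSet
  obtain ⟨κ, hκ, hlt⟩ := HasCardinalLT.exists_regular_cardinal_forall.{u}
    fun i : I.toSet => (i.1.left : Type u)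
  have : Fact κ.IsRegular := ⟨hκ⟩
  rw [rightClass_eq]
  exact ⟨κ, this, fun hc _ _ hp _ _ _ hi =>
    hasLiftingProperty_of_isUnion hc (hlt ⟨Arrow.mk _, hi⟩) fun j => hp j _ hi⟩

/-! ### The AWFS of RALIs is cocontinuous -/

theorem AWFS.IsCocontinuous.isAccessible {EM : AWFS Preord.{u}} (h : EM.IsCocontinuous) :
    EM.functor.IsAccessible.{u} := by
  have : PreservesColimitsOfSize.{u, u} EM.functor := h
  have := Cardinal.fact_isRegular_aleph0
  exact EM.functor.isAccessible_of_isCardinalAccessible Cardinal.aleph0.{u}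

namespace raliAWFS

/-- The second projection of the order relation `{(z, z') | z' ≤ z}` of `Z`. A morphism of arrows
`f ⟶ leSnd Z` is a lax cocone under `f` with vertex `Z`, so `leSnd` is right adjoint to `K`. -/
def leSnd (Z : Preord.{u}) : Arrow Preord.{u} :=
  Arrow.mk (X := Preord.of {z : Z × Z // z.2 ≤ z.1}) (Y := Z)
    (Preord.ofHom ⟨fun z => z.1.2, fun _ _ h => h.2⟩)

/-- The bijection between morphisms out of the lax colimit of `f` and lax cocones under `f`. -/
def homEquiv (f : Arrow Preord.{u}) (Z : Preord.{u}) :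
    (raliAWFS.functor.obj f ⟶ Z) ≃ (f ⟶ leSnd Z) where
  toFun d := Arrow.homMk
    (Preord.ofHom ⟨fun x => ⟨(d (.inA x), d (.inB (f.hom x))),
        d.hom.monotone (show LaxColim.LE _ _ from le_refl (f.hom x))⟩,
      fun _ _ h => ⟨d.hom.monotone h, d.hom.monotone (f.hom.hom.monotone h)⟩⟩)
    (Preord.ofHom (d.hom.comp LaxColim.incB)) rfl
  invFun s := Preord.ofHom <| LaxColim.desc
    ⟨fun x => (s.left x).1.1, fun _ _ h => (s.left.hom.monotone h).1⟩ s.right.hom fun x =>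
      le_of_eq_of_le (ConcreteCategory.congr_hom s.w x).symm (s.left x).2
  left_inv d := by ext x; cases x <;> rfl
  right_inv s := by
    ext x
    · exact Subtype.ext (Prod.ext rfl (ConcreteCategory.congr_hom s.w x).symm)
    · rfl

theorem homEquiv_naturality (f' f : Arrow Preord.{u}) (Z : Preord.{u}) (s : f' ⟶ f)
    (d : raliAWFS.functor.obj f ⟶ Z) :
    homEquiv f' Z (raliAWFS.functor.map s ≫ d) = s ≫ homEquiv f Z d := by
  ext x
  · exact Subtype.ext
      (Prod.ext rfl (congrArg (d <| .inB ·) (ConcreteCategory.congr_hom s.w x).symm))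
  · rfl

theorem isCocontinuous : raliAWFS.{u}.IsCocontinuous :=
  (Adjunction.adjunctionOfEquivRight homEquiv homEquiv_naturality).leftAdjoint_preservesColimits

end raliAWFS

/-! ### Regular cardinals as unions of complete lattices -/

section Chain

variable {α : Type u}

theorem isCompleteLattice_succChain_obj [LinearOrder α] [WellFoundedLT α] (μ : α) :
    ((Preord.succChain α).obj μ).IsCompleteLattice := by
  refine ⟨fun x y h h' => Subtype.ext (le_antisymm h h'), fun s => ?_⟩
  have top_mem : (⟨μ, le_refl μ⟩ : Set.Iic μ) ∈ upperBounds s := fun x _ => x.2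
  obtain ⟨x, hx, hmin⟩ := (wellFounded_lt (α := Set.Iic μ)).has_min (upperBounds s) ⟨_, top_mem⟩
  exact ⟨x, hx, fun y hy => not_lt.1 (hmin y hy)⟩

theorem isLUB_succChain_map [LinearOrder α] {μ ν : α} (h : μ ⟶ ν)
    (s : Set ((Preord.succChain α).obj μ)) (x : (Preord.succChain α).obj μ) (hx : IsLUB s x) :
    IsLUB ((Preord.succChain α).map h '' s) ((Preord.succChain α).map h x) := by
  refine ⟨Set.forall_mem_image.2 fun a ha => hx.1 ha, fun y hy => ?_⟩
  obtain hyμ | hμy := le_total y.1 μ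
  · exact hx.2 (show (⟨y.1, hyμ⟩ : Set.Iic μ) ∈ upperBounds s from fun a ha => hy ⟨a, ha, rfl⟩)
  · exact (le_trans x.2 hμy : x.1 ≤ y.1)

theorem isUnion_succCocone [Preorder α] : IsUnion (Preord.succCocone α) :=
  ⟨fun _ _ _ h => Subtype.ext h, fun _ _ _ h => h, fun z => ⟨z, ⟨z, le_refl z⟩, rfl⟩⟩

theorem not_isCompleteLattice_of_noMaxOrder [Preorder α] [NoMaxOrder α] :
    ¬ (Preord.of α).IsCompleteLattice := fun h => by
  obtain ⟨x, hx⟩ := h.2 Set.univ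
  obtain ⟨y, hy⟩ := exists_gt (α := α) x
  exact not_le_of_gt hy (hx.1 (Set.mem_univ y))

theorem not_isCompleteLattice_ord (β : Cardinal.{u}) [hβ : Fact β.IsRegular] :
    ¬ (Preord.of β.ord.ToType).IsCompleteLattice :=
  have := Cardinal.noMaxOrder hβ.out.aleph0_le
  not_isCompleteLattice_of_noMaxOrder

end Chain

/-- The functor sending a preorder `X` to the arrow `X ⟶ 1`. -/
def toOneFunctor : Preord.{u} ⥤ Arrow Preord.{u} where
  obj X := Arrow.mk X.toOne
  map h := Arrow.homMk h (𝟙 _) rfl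

theorem isUnion_rightFunc_toOneFunctor {J : Type w} [Category.{v} J] [Nonempty J]
    {F : J ⥤ Preord.{u}} (c : Cocone F) :
    IsUnion (Arrow.rightFunc.mapCocone (toOneFunctor.mapCocone c)) :=
  ⟨fun _ _ _ h => h, fun _ _ _ h => h, fun z => ⟨Classical.arbitrary J, z, rfl⟩⟩

namespace fullAWFS

theorem not_isCofibrantlyGenerated (EM : AWFS Preord.{u}) [EM.functor.IsAccessible.{u}] :
    ¬ fullAWFS.IsCofibrantlyGenerated EM := fun h => by
  obtain ⟨κ, _, nonempty_alg⟩ := h.exists_nonempty_alg_of_isUnion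
  have : Nonempty κ.ord.ToType := (isFiltered_of_isCardinalFiltered κ.ord.ToType κ).nonempty
  refine not_isCompleteLattice_ord κ ((nonempty_alg_toOne_iff _).1 ?_)
  exact nonempty_alg (c := toOneFunctor.mapCocone (Preord.succCocone κ.ord.ToType))
    isUnion_succCocone (isUnion_rightFunc_toOneFunctor _)
    (fun μ => algOfIsCompleteLattice (isCompleteLattice_succChain_obj μ))
    fun m => (isAlgHom_toOneSquare_iff _ _ _).2 (isLUB_succChain_map m)

theorem not_isWFSCofibrantlyGenerated : ¬ fullAWFS.{u}.IsWFSCofibrantlyGenerated := fun h => by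
  obtain ⟨κ, _, rightClass_of_isUnion⟩ := h.exists_rightClass_of_isUnion
  refine not_isCompleteLattice_ord κ ((rightClass_toOne_iff _).1 ?_)
  exact rightClass_of_isUnion (isUnion_succCocone (α := κ.ord.ToType))
    fun μ => (rightClass_toOne_iff _).2 (isCompleteLattice_succChain_obj μ)

end fullAWFS

theorem mainTheorem4_general :
    fullAWFS.{u}.IsLaxOrthogonal ∧
    (∀ {A B : Preord.{u}} (f : A ⟶ B), Nonempty (fullAWFS.Coalg f) ↔ Preord.IsFull f) ∧
    (∀ {A B : Preord.{u}} (f : A ⟶ B), fullAWFS.leftClass f ↔ Preord.IsFull f) ∧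
    (∀ X : Preord.{u}, Nonempty (fullAWFS.Alg X.toOne) ↔ X.IsCompleteLattice) ∧
    (∀ X : Preord.{u}, fullAWFS.rightClass X.toOne ↔ X.IsCompleteLattice) ∧
    (∀ {X Y : Preord.{u}} (p : fullAWFS.Alg X.toOne) (q : fullAWFS.Alg Y.toOne) (h : X ⟶ Y),
      AWFS.IsAlgHom p q (Preord.toOneSquare h) ↔
        ∀ (s : Set X) (x : X), IsLUB s x → IsLUB (h '' s) (h x)) ∧
    ¬ fullAWFS.{u}.IsCofibrantlyKZGenerated ∧
    (∀ EM : AWFS Preord.{u}, EM.functor.IsAccessible.{u} →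
      ¬ fullAWFS.{u}.IsCofibrantlyGenerated EM) ∧
    ¬ fullAWFS.{u}.IsWFSCofibrantlyGenerated ∧
    (∀ (β : Cardinal.{u}) [Fact β.IsRegular],
      IsCardinalFiltered β.ord.ToType β ∧
      (∀ μ : β.ord.ToType, ((Preord.succChain β.ord.ToType).obj μ).IsCompleteLattice) ∧
      (∀ {μ ν : β.ord.ToType} (h : μ ⟶ ν) (s : Set ((Preord.succChain β.ord.ToType).obj μ))
        (x : (Preord.succChain β.ord.ToType).obj μ), IsLUB s x →
          IsLUB ((Preord.succChain β.ord.ToType).map h '' s)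
            ((Preord.succChain β.ord.ToType).map h x)) ∧
      Nonempty (IsColimit (Preord.succCocone β.ord.ToType)) ∧
      ¬ (Preord.of β.ord.ToType).IsCompleteLattice) :=
  ⟨fullAWFS.isLaxOrthogonal, fullAWFS.nonempty_coalg_iff_isFull, fullAWFS.leftClass_iff_isFull,
    fullAWFS.nonempty_alg_toOne_iff, fullAWFS.rightClass_toOne_iff,
    fullAWFS.isAlgHom_toOneSquare_iff,
    have := raliAWFS.isCocontinuous.isAccessible
    fullAWFS.not_isCofibrantlyGenerated raliAWFS,
    fun EM _ => fullAWFS.not_isCofibrantlyGenerated EM, fullAWFS.not_isWFSCofibrantlyGenerated,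
    fun β _ =>
      have := isFiltered_of_isCardinalFiltered β.ord.ToType β
      ⟨inferInstance, isCompleteLattice_succChain_obj, isLUB_succChain_map,
        ⟨isUnion_succCocone.isColimit⟩, not_isCompleteLattice_ord β⟩⟩

theorem mainTheorem4 :
    -- the AWFS is lax orthogonal
    fullAWFS.{u}.IsLaxOrthogonal ∧
    -- its left maps are the full maps
    (∀ {A B : Preord.{u}} (f : A ⟶ B), Nonempty (fullAWFS.Coalg f) ↔ Preord.IsFull f) ∧
    (∀ {A B : Preord.{u}} (f : A ⟶ B), fullAWFS.leftClass f ↔ Preord.IsFull f) ∧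
    -- its fibrant objects are the complete lattices, with the sup-preserving maps as morphisms
    (∀ X : Preord.{u}, Nonempty (fullAWFS.Alg X.toOne) ↔ X.IsCompleteLattice) ∧
    (∀ X : Preord.{u}, fullAWFS.rightClass X.toOne ↔ X.IsCompleteLattice) ∧
    (∀ {X Y : Preord.{u}} (p : fullAWFS.Alg X.toOne) (q : fullAWFS.Alg Y.toOne) (h : X ⟶ Y),
      AWFS.IsAlgHom p q (Preord.toOneSquare h) ↔
        ∀ (s : Set X) (x : X), IsLUB s x → IsLUB (h '' s) (h x)) ∧
    -- it is not cofibrantly KZ-generated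
    ¬ fullAWFS.{u}.IsCofibrantlyKZGenerated ∧
    -- it is not cofibrantly generated with respect to any cocontinuous AWFS on preorders
    (∀ EM : AWFS Preord.{u}, EM.IsCocontinuous → ¬ fullAWFS.{u}.IsCofibrantlyGenerated EM) ∧
    -- its underlying WFS is not cofibrantly generated
    ¬ fullAWFS.{u}.IsWFSCofibrantlyGenerated ∧
    -- every regular cardinal `β` is a `β`-filtered union of the complete lattices `succ μ` and
    -- their sup-preserving inclusions, but it is not itself a complete lattice
    (∀ (β : Cardinal.{u}) [Fact β.IsRegular],
      IsCardinalFiltered β.ord.ToType β ∧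
      (∀ μ : β.ord.ToType, ((Preord.succChain β.ord.ToType).obj μ).IsCompleteLattice) ∧
      (∀ {μ ν : β.ord.ToType} (h : μ ⟶ ν) (s : Set ((Preord.succChain β.ord.ToType).obj μ))
        (x : (Preord.succChain β.ord.ToType).obj μ), IsLUB s x →
          IsLUB ((Preord.succChain β.ord.ToType).map h '' s)
            ((Preord.succChain β.ord.ToType).map h x)) ∧
      Nonempty (IsColimit (Preord.succCocone β.ord.ToType)) ∧
      ¬ (Preord.of β.ord.ToType).IsCompleteLattice) := by
  obtain ⟨lax, coalg, left, alg, right, hom, kz, accessible, wfs, ord⟩ := mainTheorem4_general.{u}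
  exact ⟨lax, coalg, left, alg, right, hom, kz, fun EM hEM => accessible EM hEM.isAccessible,
    wfs, ord⟩
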